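/- **Setting.** There are $n\ge 3$ participants, a security parameter $s$, ideal pairwise private authentic channels, and a (regular, not simultaneous) broadcast channel. Participant $i$ has inputs $x_i^j\in\{0,1,\perp\}$ for $j=1,\dots,n$: the bit it wants to send anonymously to participant $j$, or $\perp$ for none. The *ideal output* of participant $j$ is the pair $\big(|\{i: x_i^j=0\}|,\ |\{i: x_i^j=1\}|\big)$. A static active adversary controls an arbitrary set $C$ of corrupt participants: it sees all they receive, decides all they send, may use randomness and unbounded computation, and in each communication step speaks after having seen the messages of the honest participants (in an ordered broadcast: those of earlier speakers). The others are honest. **Parity.** On input bits $p_1,\dots,p_n$, each participant $i$ draws a uniformly random string $r_i\in\{0,1\}^n$ whose Hamming weight has parity $p_i$, sends $r_i^j$ privately to $j$ for every $j\neq i$ (an unsent bit is read as $0$), and computes $z_i=\bigoplus_k r_k^i$. The outcome is $\bigoplus_i z_i$, once the $z_i$ are announced. **Anonymous bit transmission.** One after the other, for each receiver $j$, a vote with the three candidates $k\in\{0,1,\perp\}$ is held: for each $k$, $s$ times, participant $i$ takes $p_i=1$ with probability $1/n$ and $p_i=0$ otherwise if $x_i^j=k$, and $p_i=0$ if $x_i^j\ne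 k$; the participants run parity on the $p_i$, but store the bits $z_i$ instead of announcing them. Then all stored strings are sent privately to $j$, who computes, for each $k$, the fraction $\sigma_k$ of the $s$ repetitions in which the parity $\bigoplus_i z_i$ was odd, and decodes it to a number $y_k\in\{0,\dots,n\}$ with $|\sigma_k-p_{y_k}|<\frac{1}{2e^2n}$, where $$p_v=\tfrac12\Big(\tfrac{n-2}{n}\Big)^v\Big(\big(\tfrac{n}{n-2}\big)^v-1\Big)$$ (if several numbers qualify, any fixed rule chooses one). If a string is missing, some $y_k$ does not exist, or $\sum_k y_k\ne n$, then $j$ aborts its tally and sets its success bit $s_j=1$; otherwise $s_j=0$ and $j$ obtains the counts $(y_0,y_1)$. Finally a veto is run on the bits $s_j$: for each of $n$ agreed orderings of the participants with pairwise different last participants, $s$ times, participant $i$ takes $p_i=0$ if $s_i=0$ and a fair coin $p_i$ if $s_i=1$, and parity is run on the $p_i$ with the $z_i$ broadcast in that ordering. The protocol fails (aborts) if in some repetition the outcome is $1$ or somebody refuses to broadcast; otherwise it succeeds. **Lemma (Correctness).** There are absolute constants $K,c>0$ such that for all $n\ge3$, all $s\ge 0$, all orderings and decoding rules as above, and all inputs: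 1. if all participants are honest, then, except with probability at most $Kn\,e^{-cs/n^2}$, the protocol succeeds and every participant obtains its ideal output; 2. for every set $C$ of corrupt participants and every adversary controlling it, except with probability at most $Kn\,e^{-cs/n^2}$, either the protocol aborts or there are inputs for the corrupt participants such that every honest participant obtains its ideal output with respect to these inputs and the actual inputs of the honest participants. In particular, for fixed $n$ the error probability is exponentially small in $s$. -/

import Mathlib

open scoped NNReal ENNReal

noncomputable section

namespace AnonBit

/-! ### Sampling and sequential composition

Bits live in `ZMod 2`, so that the exclusive or of bits is their sum. -/

/-- The coin that is `1` with probability `q` and `0` with probability `1 - q`. -/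
def coin (q : ℝ≥0∞) (hq : q ≤ 1) : PMF (ZMod 2) :=
  PMF.ofFintype (fun b => if b = 1 then q else 1 - q) (by
    have h : (Finset.univ : Finset (ZMod 2)) = {0, 1} := by decide
    have h01 : (0 : ZMod 2) ≠ 1 := by decide
    rw [h, Finset.sum_pair h01]
    simp [tsub_add_cancel_of_le hq])

/-- Independent samples, one from each of the distributions `p i`. -/
def indep {ι α : Type} [Fintype ι] [DecidableEq ι] [Fintype α] (p : ι → PMF α) : PMF (ι → α) :=
  PMF.ofFintype (fun f => ∏ i, p i (f i)) (by
    have h := Finset.prod_univ_sum (fun _ : ι => (Finset.univ : Finset α)) (fun i a => p i a)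
    rw [Fintype.piFinset_univ] at h
    rw [← h]
    refine Finset.prod_eq_one fun i _ => ?_
    rw [← tsum_fintype (L := .unconditional _)]
    exact (p i).tsum_coe)

/-- Run `body 0`, `body 1`, …, `body (m - 1)` one after the other, passing a state of type `σ` along
and collecting the results. -/
def loop {σ α : Type} : (m : ℕ) → (Fin m → σ → PMF (σ × α)) → σ → PMF (σ × (Fin m → α))
  | 0, _, st => PMF.pure (st, Fin.elim0)
  | m + 1, body, st =>
      (body 0 st).bind fun a =>
      (loop m (fun i => body i.succ) a.1).bind fun b =>
      PMF.pure (b.1, Fin.cons a.2 b.2)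

/-! ### The adversary -/

/-- The bits that one participant stores during a three-choice vote with `s` repetitions: one for
each candidate and each repetition. -/
abbrev Strings (s : ℕ) : Type := Fin 3 → Fin s → ZMod 2

/-- A static active adversary in control of the set `C` of corrupt participants. It keeps an
arbitrary internal state, may use randomness in every step, sees everything that a corrupt
participant receives or that is broadcast, and decides everything that corrupt participants send.
In each communication step it speaks after it has seen the messages of the honest participants
(for broadcasts: of those that come earlier in the current ordering). -/
structure Adversary (n s : ℕ) (C : Finset (Fin n)) where
  /-- The internal states. -/
  State : Type
  /-- The state at the start. -/
  init : State
  /-- In an execution of parity: having seen the private bits sent by honest to corrupt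
  participants, choose the private bits sent by corrupt to honest participants (a bit that is not
  sent is read as `0`). -/
  share : State → ({i // i ∉ C} → {j // j ∈ C} → ZMod 2) →
    PMF (State × ({i // i ∈ C} → {j // j ∉ C} → ZMod 2))
  /-- At the end of a vote with an honest receiver: choose the strings that the corrupt participants
  send privately to the receiver; `none` is a refusal. -/
  sendStrings : State → PMF (State × ({i // i ∈ C} → Option (Strings s)))
  /-- At the end of a vote with a corrupt receiver: see the strings that the honest participants
  send privately to the receiver. -/
  seeStrings : State → ({i // i ∉ C} → Strings s) → PMF State
  /-- Choose the broadcast of a corrupt participant whose turn it is; `none` is a refusal. -/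
  speak : State → {i // i ∈ C} → PMF (State × Option (ZMod 2))
  /-- Hear the broadcast of an honest participant. -/
  hear : State → {i // i ∉ C} → ZMod 2 → PMF State

/-! ### Parity -/

/-- The `n`-bit strings whose Hamming weight has parity `x`. -/
def parityStrings (n : ℕ) (x : ZMod 2) : Finset (Fin n → ZMod 2) :=
  Finset.univ.filter fun r => ∑ j, r j = x

theorem parityStrings_nonempty {n : ℕ} (i : Fin n) (x : ZMod 2) : (parityStrings n x).Nonempty :=
  ⟨Pi.single i x, by simp [parityStrings]⟩

/-- The string that participant `i` with input `x` draws in parity: uniform among the `n`-bit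
strings of parity `x`. -/
def shareString {n : ℕ} (i : Fin n) (x : ZMod 2) : PMF (Fin n → ZMod 2) :=
  PMF.uniformOfFinset (parityStrings n x) (parityStrings_nonempty i x)

/-- The private part of parity, with input `p i` for each honest participant `i`: the honest
participants draw their strings `r i` and send the bit `r i j` to participant `j`, the corrupt
participants send what the adversary likes, and each honest participant adds up the bits it holds.
Returned are these sums `z`, which the honest participants have not announced yet. -/
def parityShares {n s : ℕ} {C : Finset (Fin n)} (A : Adversary n s C) (p : {i // i ∉ C} → ZMod 2)
    (st : A.State) : PMF (A.State × ({i // i ∉ C} → ZMod 2)) :=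
  (indep fun i : {i // i ∉ C} => shareString i.1 (p i)).bind fun r =>
  (A.share st fun i j => r i j.1).bind fun a =>
  PMF.pure (a.1, fun l => ∑ i : Fin n, if h : i ∈ C then a.2 ⟨i, h⟩ l else r ⟨i, h⟩ l.1)

/-! ### The vote, with three choices and a receiver -/

/-- A participant's coin in the round of candidate `k`: if the vote is for `k`, it is `1` with
probability `1 / n`; otherwise it is `0`. -/
def voteCoin (n : ℕ) (vote k : Fin 3) : PMF (ZMod 2) :=
  if vote = k then
    coin (((n : ℝ≥0)⁻¹ : ℝ≥0) : ℝ≥0∞) (by exact_mod_cast (Nat.cast_inv_le_one n : ((n : ℝ≥0)⁻¹) ≤ 1))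
  else PMF.pure 0

/-- The first phase of the vote: for each candidate, `s` times, draw the coins and run the private
part of parity; each honest participant stores its bit instead of announcing it. -/
def votePhase {n s : ℕ} {C : Finset (Fin n)} (A : Adversary n s C) (vote : Fin n → Fin 3)
    (st : A.State) : PMF (A.State × (Fin 3 → Fin s → {i // i ∉ C} → ZMod 2)) :=
  loop 3 (fun k => loop s fun _ st' =>
    (indep fun i : {i // i ∉ C} => voteCoin n (vote i.1) k).bind fun p =>
    parityShares A p st') st

/-- The probability that the parity is odd if `v` of `n` participants flip with
probability `1 / n`. -/
def oddProb (n v : ℕ) : ℝ :=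
  1 / 2 * (((n : ℝ) - 2) / n) ^ v * (((n : ℝ) / ((n : ℝ) - 2)) ^ v - 1)

/-- `dec` decodes an observed frequency `x` into a number `v ≤ n` of votes with
`|x - oddProb n v| < 1 / (2 e² n)`, and into `none` exactly if there is no such number. (If there are
several, any rule for choosing one is allowed.) -/
def IsDecoder (n : ℕ) (dec : ℝ → Option ℕ) : Prop :=
  ∀ x : ℝ,
    (∀ v, dec x = some v → v ≤ n ∧ |x - oddProb n v| < 1 / (2 * Real.exp 1 ^ 2 * n)) ∧
    (dec x = none → ∀ v ≤ n, ¬ |x - oddProb n v| < 1 / (2 * Real.exp 1 ^ 2 * n))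

/-- The fraction of the repetitions for candidate `k` in which the parity was odd. -/
def oddFrequency {n s : ℕ} (w : Fin n → Strings s) (k : Fin 3) : ℝ :=
  (∑ t : Fin s, ((∑ i : Fin n, w i k t).val : ℝ)) / s

/-- The tally computed from the strings of all participants. It aborts (`none`) if a participant
refused to send its string, if the frequency of some candidate cannot be decoded, or if the numbers
of votes do not add up to `n`. -/
def tally {n s : ℕ} (dec : ℝ → Option ℕ) (w : Fin n → Option (Strings s)) :
    Option (Fin 3 → ℕ) :=
  let y : Fin 3 → Option ℕ := fun k => dec (oddFrequency (fun i => (w i).getD 0) k)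
  if (∀ i, w i ≠ none) ∧ (∀ k, y k ≠ none) ∧ ∑ k, (y k).getD 0 = n then
    some fun k => (y k).getD 0
  else none

/-- The vote for receiver `j`, in which participant `i` votes `vote i`. All output strings are sent to
`j` through the private channels. If `j` is honest, the result is the tally that `j` computes. If `j`
is corrupt, the strings go to the adversary and the result is the dummy value `none`. -/
def voteFor {n s : ℕ} {C : Finset (Fin n)} (A : Adversary n s C) (dec : ℝ → Option ℕ)
    (vote : Fin n → Fin 3) (j : Fin n) (st : A.State) :
    PMF (A.State × Option (Fin 3 → ℕ)) :=
  (votePhase A vote st).bind fun a =>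
  if j ∈ C then
    (A.seeStrings a.1 fun i k t => a.2 k t i).bind fun st' => PMF.pure (st', none)
  else
    (A.sendStrings a.1).bind fun b =>
    PMF.pure (b.1, tally dec fun i =>
      if h : i ∈ C then b.2 ⟨i, h⟩ else some fun k t => a.2 k t ⟨i, h⟩)

/-! ### The veto -/

/-- `n` orderings of the participants, where `ord a t` is the participant who speaks at position `t` in
ordering `a`, such that different orderings have different last participants. -/
def IsOrderings {n : ℕ} (ord : Fin n → Equiv.Perm (Fin n)) : Prop :=
  ∀ (a b t : Fin n), (t : ℕ) + 1 = n → ord a t = ord b t → a = b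

/-- A participant's coin in the veto: `0` if its input is `false`, fair if its input is `true`. -/
def vetoCoin (input : Bool) : PMF (ZMod 2) :=
  if input then coin 2⁻¹ (by simp) else PMF.pure 0

/-- One repetition in the veto: draw the coins and run parity, with broadcasts in the ordering `o`.
The result is `true` if somebody refuses to broadcast or the outcome of parity is `1`. -/
def vetoRound {n s : ℕ} {C : Finset (Fin n)} (A : Adversary n s C) (input : Fin n → Bool)
    (o : Equiv.Perm (Fin n)) (st : A.State) : PMF (A.State × Bool) :=
  (indep fun i : {i // i ∉ C} => vetoCoin (input i.1)).bind fun p =>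
  (parityShares A p st).bind fun a =>
  (loop n (fun t st' =>
      if h : o t ∈ C then A.speak st' ⟨o t, h⟩
      else (A.hear st' ⟨o t, h⟩ (a.2 ⟨o t, h⟩)).bind fun st'' =>
        PMF.pure (st'', some (a.2 ⟨o t, h⟩))) a.1).bind fun b =>
  PMF.pure (b.1, decide ((∃ t, b.2 t = none) ∨ ∑ t, (b.2 t).getD 0 = 1))

/-- The veto: `s` repetitions for each of the orderings. The result is `true` if it is `true` in some
repetition. The inputs of corrupt participants are not used. -/
def veto {n s : ℕ} {C : Finset (Fin n)} (A : Adversary n s C) (ord : Fin n → Equiv.Perm (Fin n))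
    (input : Fin n → Bool) (st : A.State) : PMF (A.State × Bool) :=
  (loop n (fun a => loop s fun _ st' => vetoRound A input (ord a) st') st).bind fun b =>
  PMF.pure (b.1, decide (∃ a t, b.2 a t = true))

/-! ### Anonymous bit transmission -/

/-- The inputs: `x i j` is what participant `i` wants to send to participant `j`, where `0` and `1`
stand for the bits and `2` stands for abstaining. -/
abbrev Inputs (n : ℕ) : Type := Fin n → Fin n → Fin 3

/-- What an execution produces: `none` if it fails (aborts), and otherwise for each participant the
numbers of `0`s and of `1`s it has received, or `none` if it has no such numbers. The entries of
corrupt participants have no meaning. -/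
abbrev Outcome (n : ℕ) : Type := Option (Fin n → Option (ℕ × ℕ))

/-- Anonymous bit transmission: one vote for each receiver, then a veto whose inputs are the success
bits (`true` if the tally of that receiver has aborted). The inputs `x i` of corrupt participants `i`
are not used. -/
def transmission {n s : ℕ} {C : Finset (Fin n)} (A : Adversary n s C)
    (ord : Fin n → Equiv.Perm (Fin n)) (dec : ℝ → Option ℕ) (x : Inputs n) : PMF (Outcome n) :=
  (loop n (fun j st => voteFor A dec (fun i => x i j) j st) A.init).bind fun a =>
  (veto A ord (fun j => (a.2 j).isNone) a.1).bind fun b =>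
  PMF.pure (if b.2 then none else some fun j => (a.2 j).map fun y => (y 0, y 1))

/-- The ideal output of participant `j`: how many participants send it a `0` and how many a `1`. -/
def ideal {n : ℕ} (x : Inputs n) (j : Fin n) : ℕ × ℕ :=
  ((Finset.univ.filter fun i => x i j = 0).card, (Finset.univ.filter fun i => x i j = 1).card)

/-- The outcome is correct if the protocol has aborted, or if there are inputs for the corrupt
participants with which every honest participant has obtained its ideal output. -/
def IsCorrect {n : ℕ} (C : Finset (Fin n)) (x : Inputs n) (o : Outcome n) : Prop :=
  o = none ∨ ∃ y, o = some y ∧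
    ∃ x' : Inputs n, (∀ i, i ∉ C → x' i = x i) ∧ ∀ j, j ∉ C → y j = some (ideal x' j)

end AnonBit

end

noncomputable section

namespace AnonBit

/-! ### Expectations -/

/-! Tampering can only push the observed frequencies up, and the condition that the counts add up to
`n` keeps such a push harmless.

In parity, adding `p i` to the bit that participant `i` keeps for itself turns a run with zero
inputs into a run with inputs `p`. Nothing that reaches a corrupt participant changes, and the
honest stored bits are translated by `p` (`expect_parityShares`). So the honest contribution to a
voting round is a blank value, possibly chosen by the adversary, plus the parity of the honest
coins, which is independent of the adversary's view (`expect_votePhase`). This survives adaptivity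
across rounds by `expect_loop_add_noise`.

With `v` honest votes the coin parity is odd with probability `oddProb n v = (1 - (1 - 2/n)^v) / 2`,
which is at most `1/2`. A fixed offset replaces this by itself or by its complement, never by less.
By a Chernoff bound the frequency is therefore unlikely to fall `margin n` below `oddProb n v`
(`prob_frequency_le`). Consecutive values of `oddProb` are far enough apart (`margin_add_le`) that
every decoded count is then at least the number of honest votes. As the counts sum to `n`, the
surplus is exactly the number of corrupt participants and can be distributed among them as votes
(`exists_votes`).

If an honest tally aborts, some veto ordering has that receiver last. Its fair coin acts only after
all other broadcasts, so each of the `s` repetitions passes with probability at most `1/2`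
(`prob_vetoRound_le`). A union bound over receivers finishes the proof. With everybody honest the
offsets vanish, both tails are controlled, and the veto passes almost surely. -/

/-- The expectation of a function with values in `ℝ≥0∞`. -/
def expect {α : Type} (p : PMF α) (f : α → ℝ≥0∞) : ℝ≥0∞ := ∑' a, p a * f a

section expect

variable {α β : Type}

theorem expect_pure (a : α) (f : α → ℝ≥0∞) : expect (PMF.pure a) f = f a := by
  classical
  unfold expect
  rw [tsum_eq_single a]
  · simp
  · intro b hb
    simp [hb]

theorem expect_bind (p : PMF α) (q : α → PMF β) (f : β → ℝ≥0∞) :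
    expect (p.bind q) f = expect p fun a => expect (q a) f := by
  unfold expect
  simp_rw [PMF.bind_apply, ← ENNReal.tsum_mul_right, ← ENNReal.tsum_mul_left]
  rw [ENNReal.tsum_comm]
  simp_rw [mul_assoc]

theorem expect_mono (p : PMF α) {f g : α → ℝ≥0∞} (h : ∀ a, f a ≤ g a) :
    expect p f ≤ expect p g :=
  ENNReal.tsum_le_tsum fun a => mul_le_mul_right (h a) _

theorem expect_const (p : PMF α) (c : ℝ≥0∞) : (expect p fun _ => c) = c := by
  unfold expect
  rw [ENNReal.tsum_mul_right, p.tsum_coe, one_mul]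

theorem expect_le (p : PMF α) {f : α → ℝ≥0∞} {c : ℝ≥0∞} (h : ∀ a, f a ≤ c) :
    expect p f ≤ c :=
  (expect_mono p h).trans_eq (expect_const p c)

theorem expect_add (p : PMF α) (f g : α → ℝ≥0∞) :
    (expect p fun a => f a + g a) = expect p f + expect p g := by
  unfold expect
  simp_rw [mul_add]
  exact ENNReal.tsum_add

theorem expect_const_mul (p : PMF α) (c : ℝ≥0∞) (f : α → ℝ≥0∞) :
    (expect p fun a => c * f a) = c * expect p f := by
  unfold expect
  rw [← ENNReal.tsum_mul_left]
  exact tsum_congr fun a => by ring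

theorem expect_finset_sum {ι : Type} (s : Finset ι) (p : PMF α) (f : ι → α → ℝ≥0∞) :
    (expect p fun a => ∑ i ∈ s, f i a) = ∑ i ∈ s, expect p (f i) := by
  classical
  induction s using Finset.induction_on with
  | empty => simpa using expect_const p 0
  | insert i s hi ih => simp_rw [Finset.sum_insert hi, expect_add, ih]

theorem expect_comm (p : PMF α) (q : PMF β) (f : α → β → ℝ≥0∞) :
    (expect p fun a => expect q fun b => f a b) = expect q fun b => expect p fun a => f a b := by
  unfold expect
  simp_rw [← ENNReal.tsum_mul_left]
  rw [ENNReal.tsum_comm]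
  exact tsum_congr fun b => tsum_congr fun a => by ring

/-- Change of variables along a weight-preserving bijection. It carries both couplings: the shift of
the shares by the inputs, and the flip of the last speaker's coin. -/
theorem expect_equiv (p : PMF α) (q : PMF β) (e : α ≃ β) (h : ∀ a, p a = q (e a))
    (f : β → ℝ≥0∞) : (expect p fun a => f (e a)) = expect q f := by
  unfold expect
  simp_rw [h]
  exact e.tsum_eq fun b => q b * f b

theorem toOuterMeasure_eq_expect (p : PMF α) (s : Set α) :
    p.toOuterMeasure s = expect p (s.indicator 1) := by
  rw [PMF.toOuterMeasure_apply]
  refine tsum_congr fun a => ?_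
  by_cases h : a ∈ s <;> simp [h]

end expect

/-- The probability of an event, as an expectation. -/
def prob {α : Type} (p : PMF α) (S : α → Prop) : ℝ≥0∞ := expect p (Set.indicator {a | S a} 1)

section prob

variable {α β : Type}

theorem prob_mono (p : PMF α) {S T : α → Prop} (h : ∀ a, S a → T a) : prob p S ≤ prob p T :=
  expect_mono p fun a => Set.indicator_le_indicator_of_subset (fun a => h a) (by simp) a

theorem prob_le_one (p : PMF α) (S : α → Prop) : prob p S ≤ 1 :=
  expect_le p fun a => by by_cases h : S a <;> simp [h]

theorem prob_bind (p : PMF α) (q : α → PMF β) (S : β → Prop) :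
    prob (p.bind q) S = expect p fun a => prob (q a) S := expect_bind p q _

theorem prob_pure (a : α) (S : α → Prop) [Decidable (S a)] :
    prob (PMF.pure a) S = if S a then 1 else 0 := by
  rw [prob, expect_pure]
  simp [Set.indicator_apply]

theorem prob_pure_of_not {a : α} {S : α → Prop} (h : ¬ S a) : prob (PMF.pure a) S = 0 := by
  classical
  rw [prob_pure, if_neg h]

theorem prob_bind_pure (p : PMF α) (g : α → β) (S : β → Prop) :
    prob (p.bind fun a => PMF.pure (g a)) S = prob p fun a => S (g a) := by
  classical
  rw [prob_bind]
  refine congrArg _ (funext fun a => ?_)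
  rw [prob_pure]
  simp [Set.indicator_apply]

theorem prob_exists_le {ι : Type} [Fintype ι] (p : PMF α) (S : ι → α → Prop) :
    (prob p fun a => ∃ i, S i a) ≤ ∑ i, prob p (S i) := by
  classical
  unfold prob
  rw [← expect_finset_sum]
  refine expect_mono p fun a => ?_
  by_cases h : ∃ i, S i a
  · obtain ⟨i, hi⟩ := h
    refine (Finset.single_le_sum (f := fun i => Set.indicator {a | S i a} (1 : α → ℝ≥0∞) a)
      (fun _ _ => zero_le) (Finset.mem_univ i)).trans' ?_
    simp only [Set.indicator_apply, Set.mem_ofPred_eq, hi, if_true]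
    split_ifs <;> simp
  · simp [h]

theorem prob_or_le (p : PMF α) (S T : α → Prop) :
    (prob p fun a => S a ∨ T a) ≤ prob p S + prob p T := by
  classical
  unfold prob
  rw [← expect_add]
  refine expect_mono p fun a => ?_
  by_cases h : S a <;> by_cases h' : T a <;> simp [h, h']

/-- If `S` can only happen after `T` or with probability at most `c`, then its probability is at
most that of `T` plus `c`. -/
theorem prob_bind_le_add {p : PMF α} {q : α → PMF β} {S : β → Prop} {T : α → Prop} {c : ℝ≥0∞}
    (h : ∀ a, ¬ T a → prob (q a) S ≤ c) : prob (p.bind q) S ≤ prob p T + c := by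
  rw [prob_bind, prob, ← expect_const p c, ← expect_add]
  refine expect_mono p fun a => ?_
  by_cases hT : T a
  · refine (prob_le_one _ _).trans ?_
    simp [hT]
  · exact (h a hT).trans le_add_self

end prob

/-! ### Independent samples -/

section indep

variable {ι α : Type} [Fintype ι] [DecidableEq ι] [Fintype α]

theorem indep_apply (p : ι → PMF α) (f : ι → α) : indep p f = ∏ i, p i (f i) := rfl

theorem expect_fintype (p : PMF α) (f : α → ℝ≥0∞) : expect p f = ∑ a, p a * f a :=
  tsum_fintype _

theorem expect_indep_prod (p : ι → PMF α) (f : ι → α → ℝ≥0∞) :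
    (expect (indep p) fun x => ∏ i, f i (x i)) = ∏ i, expect (p i) (f i) := by
  simp_rw [expect_fintype, indep_apply, ← Finset.prod_mul_distrib]
  rw [Finset.prod_univ_sum, Fintype.piFinset_univ]

theorem expect_indep_eval (p : ι → PMF α) (i : ι) (f : α → ℝ≥0∞) :
    (expect (indep p) fun x => f (x i)) = expect (p i) f := by
  have h := expect_indep_prod p fun j a => if j = i then f a else 1
  simp only [Finset.prod_ite_eq', Finset.mem_univ, if_true] at h
  rw [h, Finset.prod_eq_single i]
  · simp
  · intro j _ hj
    simpa [hj] using expect_const (p j) 1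
  · simp

theorem expect_indep_cons {m : ℕ} (p : Fin (m + 1) → PMF α) (F : (Fin (m + 1) → α) → ℝ≥0∞) :
    expect (indep p) F =
      expect (p 0) fun a => expect (indep fun i : Fin m => p i.succ) fun f => F (Fin.cons a f) := by
  simp_rw [expect_fintype, Finset.mul_sum]
  rw [← Fintype.sum_prod_type' (f := fun a f => p 0 a * (indep (fun i : Fin m => p i.succ) f *
    F (Fin.cons a f))), ← (Fin.consEquiv fun _ => α).sum_comp]
  refine Finset.sum_congr rfl fun x _ => ?_
  simp [indep_apply, Fin.prod_univ_succ, mul_assoc, Fin.consEquiv]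

end indep

/-! ### Loops -/

section loop

variable {σ α : Type}

/-- The bound on each round is uniform in the incoming state. Hence the bounds multiply without any
independence, whatever the adversary remembers. -/
theorem prob_loop_forall_le {m : ℕ} (body : Fin m → σ → PMF (σ × α)) (S : Fin m → α → Prop)
    (c : Fin m → ℝ≥0∞) (h : ∀ i st, (prob (body i st) fun x => S i x.2) ≤ c i) (st : σ) :
    (prob (loop m body st) fun x => ∀ i, S i (x.2 i)) ≤ ∏ i, c i := by
  classical
  induction m generalizing st with
  | zero => exact (prob_le_one _ _).trans (by simp)
  | succ m ih =>
    rw [loop, prob_bind, Fin.prod_univ_succ]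
    have key : ∀ a : σ × α, (prob ((loop m (fun i => body i.succ) a.1).bind fun b =>
        PMF.pure (b.1, (Fin.cons a.2 b.2 : Fin (m + 1) → α))) fun x => ∀ i, S i (x.2 i)) ≤
        (∏ i : Fin m, c i.succ) * Set.indicator {a : σ × α | S 0 a.2} 1 a := by
      intro a
      rw [prob_bind_pure]
      by_cases h0 : S 0 a.2
      · refine (prob_mono _ fun b hb i => ?_).trans ((ih (fun i => body i.succ)
          (fun i => S i.succ) (fun i => c i.succ) (fun i => h i.succ) a.1).trans ?_)
        · simpa using hb i.succ
        · simp [h0]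
      · refine (prob_mono (T := fun _ => False) _ fun b hb => ?_).trans ?_
        · exact h0 (by simpa using hb 0)
        · simp [prob, expect]
    refine (expect_mono _ key).trans ?_
    rw [expect_const_mul, mul_comm]
    exact mul_le_mul_left (h 0 st) _

theorem prob_loop_exists_le {m : ℕ} (body : Fin m → σ → PMF (σ × α)) (S : Fin m → α → Prop)
    (c : Fin m → ℝ≥0∞) (h : ∀ i st, (prob (body i st) fun x => S i x.2) ≤ c i) (st : σ) :
    (prob (loop m body st) fun x => ∃ i, S i (x.2 i)) ≤ ∑ i, c i := by
  induction m generalizing st with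
  | zero => simp [prob, expect]
  | succ m ih =>
    rw [loop, Fin.sum_univ_succ]
    refine (prob_bind_le_add (T := fun x => S 0 x.2) fun a ha => ?_).trans
      (add_le_add_left (h 0 st) _)
    rw [prob_bind_pure]
    refine (prob_mono _ fun b hb => ?_).trans (ih (fun i => body i.succ)
          (fun i => S i.succ) (fun i => c i.succ) (fun i => h i.succ) a.1)
    obtain ⟨i, hi⟩ := hb
    induction i using Fin.cases with
    | zero => exact absurd (by simpa using hi) ha
    | succ i => exact ⟨i, by simpa using hi⟩

/-- `loop` splits off its first round; the argument about the last speaker needs the last one. -/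
theorem loop_snoc {m : ℕ} (body : Fin (m + 1) → σ → PMF (σ × α)) (st : σ) :
    loop (m + 1) body st = (loop m (fun i => body i.castSucc) st).bind fun a =>
      (body (Fin.last m) a.1).bind fun b =>
      PMF.pure (b.1, (Fin.snoc a.2 b.2 : Fin (m + 1) → α)) := by
  induction m generalizing st with
  | zero =>
    rw [loop, loop, PMF.pure_bind]
    refine congrArg _ (funext fun a => ?_)
    rw [loop, PMF.pure_bind]
    refine congrArg _ (Prod.ext rfl (funext fun i => ?_))
    obtain rfl : i = Fin.last 0 := Subsingleton.elim (α := Fin 1) _ _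
    simp only [Fin.snoc_last]
    rfl
  | succ m ih =>
    rw [loop, loop, PMF.bind_bind]
    refine congrArg _ (funext fun a => ?_)
    rw [ih, PMF.bind_bind, PMF.bind_bind]
    refine congrArg _ (funext fun b => ?_)
    rw [PMF.bind_bind, PMF.pure_bind]
    refine congrArg _ (funext fun d => ?_)
    rw [PMF.pure_bind]
    simp only [Fin.cons_snoc_eq_snoc_cons]

/-- If the results of `body`, as seen through `g`, are those of `sim` plus independent noise, then the
same holds for the loop. -/
theorem expect_loop_add_noise {γ : Type} [AddCommGroup γ] [Fintype γ] {m : ℕ} (g : α → γ)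
    (body : Fin m → σ → PMF (σ × α)) (sim : Fin m → σ → PMF (σ × γ)) (q : Fin m → PMF γ)
    (h : ∀ i st (F : σ → γ → ℝ≥0∞), (expect (body i st) fun x => F x.1 (g x.2)) =
      expect (sim i st) fun x => expect (q i) fun u => F x.1 (x.2 + u))
    (st : σ) (F : σ → (Fin m → γ) → ℝ≥0∞) :
    (expect (loop m body st) fun x => F x.1 fun i => g (x.2 i)) =
      expect (loop m sim st) fun x => expect (indep q) fun u => F x.1 (x.2 + u) := by
  induction m generalizing st with
  | zero =>
    rw [loop, loop, expect_pure, expect_pure, ← expect_const (indep q) (F _ _)]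
    refine congrArg _ (funext fun u => congrArg _ (Subsingleton.elim _ _))
  | succ m ih =>
    rw [loop, loop, expect_bind, expect_bind]
    simp_rw [expect_bind, expect_pure, expect_indep_cons]
    -- `G` is the simulated continuation as a function of the state and the first masked result.
    -- Packaged as one function, it is a test function to which `h 0` applies.
    obtain ⟨G, hG⟩ : ∃ G : σ → γ → ℝ≥0∞, ∀ s' w, G s' w =
        expect (loop m (fun i => sim i.succ) s') fun b =>
          expect (indep fun i : Fin m => q i.succ) fun u => F b.1 (Fin.cons w (b.2 + u)) :=
      ⟨_, fun _ _ => rfl⟩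
    have e1 : ∀ a : σ × α, (expect (loop m (fun i => body i.succ) a.1) fun b =>
        F b.1 fun i => g ((Fin.cons a.2 b.2 : Fin (m + 1) → α) i)) = G a.1 (g a.2) := by
      intro a
      rw [hG, ← ih (fun i => body i.succ) (fun i => sim i.succ) (fun i => q i.succ)
        (fun i => h i.succ) a.1 (fun s' w => F s' (Fin.cons (g a.2) w))]
      refine congrArg _ (funext fun b => congrArg _ (funext fun i => ?_))
      induction i using Fin.cases <;> simp
    simp_rw [e1]
    rw [h 0 st G]
    simp_rw [hG]
    refine congrArg _ (funext fun a => ?_)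
    -- The simulated continuation does not see the first round's noise, so that noise may be drawn
    -- after it.
    rw [expect_comm]
    refine congrArg _ (funext fun b => congrArg _ (funext fun u => congrArg _ (funext fun v => ?_)))
    refine congrArg _ (funext fun i => ?_)
    induction i using Fin.cases <;> simp

end loop

/-! ### Tail bounds -/

theorem exp_le_one_add_add_sq {x : ℝ} (hx : |x| ≤ 1) : Real.exp x ≤ 1 + x + x ^ 2 := by
  have h := (abs_le.1 (Real.abs_exp_sub_one_sub_id_le hx)).2
  linarith

theorem sum_toReal_eq_one {α : Type} [Fintype α] (p : PMF α) : ∑ a, (p a).toReal = 1 := by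
  rw [← ENNReal.toReal_sum fun a _ => p.apply_ne_top a, ← tsum_fintype (L := .unconditional _),
    p.tsum_coe, ENNReal.toReal_one]

theorem expect_ofReal {α : Type} [Fintype α] (p : PMF α) {f : α → ℝ} (hf : ∀ a, 0 ≤ f a) :
    (expect p fun a => ENNReal.ofReal (f a)) = ENNReal.ofReal (∑ a, (p a).toReal * f a) := by
  rw [expect_fintype, ENNReal.ofReal_sum_of_nonneg fun a _ => by have := hf a; positivity]
  refine Finset.sum_congr rfl fun a _ => ?_
  rw [ENNReal.ofReal_mul ENNReal.toReal_nonneg, ENNReal.ofReal_toReal (p.apply_ne_top a)]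

/-- Expand the exponential to second order: the linear term has nonpositive mean because `l ≥ 0`,
and the square is at most `l ^ 2`. -/
theorem expect_exp_le {α : Type} [Fintype α] (p : PMF α) {X : α → ℝ} (hX : ∀ a, |X a| ≤ 1)
    (hm : ∑ a, (p a).toReal * X a ≤ 0) {l : ℝ} (hl : 0 ≤ l) (hl' : l ≤ 1) :
    (expect p fun a => ENNReal.ofReal (Real.exp (l * X a))) ≤
      ENNReal.ofReal (Real.exp (l ^ 2)) := by
  rw [expect_ofReal p fun a => (Real.exp_pos _).le]
  refine ENNReal.ofReal_le_ofReal ?_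
  have h1 : ∀ a, Real.exp (l * X a) ≤ 1 + l * X a + l ^ 2 := by
    intro a
    have habs : |l * X a| ≤ 1 := by
      rw [abs_mul, abs_of_nonneg hl]
      exact mul_le_one₀ hl' (abs_nonneg _) (hX a)
    have hsq : X a ^ 2 ≤ 1 := (sq_le_one_iff_abs_le_one _).2 (hX a)
    have h2 := exp_le_one_add_add_sq habs
    have h3 : (l * X a) ^ 2 ≤ l ^ 2 := by
      rw [mul_pow]
      exact mul_le_of_le_one_right (sq_nonneg l) hsq
    linarith
  calc ∑ a, (p a).toReal * Real.exp (l * X a)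
      ≤ ∑ a, (p a).toReal * (1 + l * X a + l ^ 2) :=
        Finset.sum_le_sum fun a _ => mul_le_mul_of_nonneg_left (h1 a) ENNReal.toReal_nonneg
    _ = (∑ a, (p a).toReal) * (1 + l ^ 2) + l * ∑ a, (p a).toReal * X a := by
        rw [Finset.sum_mul, Finset.mul_sum, ← Finset.sum_add_distrib]
        exact Finset.sum_congr rfl fun a _ => by ring
    _ ≤ 1 + l ^ 2 := by
        rw [sum_toReal_eq_one, one_mul]
        have := mul_nonpos_of_nonneg_of_nonpos hl hm
        linarith
    _ ≤ Real.exp (l ^ 2) := by linarith [Real.add_one_le_exp (l ^ 2)]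

/-- A Chernoff bound: a sum of independent variables with values in `[-1, 1]` and with nonpositive
means is unlikely to be large. -/
theorem prob_indep_sum_ge_le {α : Type} [Fintype α] {s : ℕ} (p : PMF α) {X : Fin s → α → ℝ}
    (hX : ∀ t a, |X t a| ≤ 1) (hm : ∀ t, ∑ a, (p a).toReal * X t a ≤ 0) {d : ℝ} (hd : 0 ≤ d)
    (hd' : d ≤ 1) :
    (prob (indep fun _ : Fin s => p) fun u => s * d ≤ ∑ t, X t (u t)) ≤
      ENNReal.ofReal (Real.exp (-(d ^ 2 / 4 * s))) := by
  -- Markov's inequality for the exponential moment with parameter `l = d / 2`, which minimizes `l ^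
  -- 2 - l * d` and gives the exponent `-d ^ 2 / 4` per sample.
  have h1 : ∀ u : Fin s → α, Set.indicator {u | s * d ≤ ∑ t, X t (u t)} (1 : (Fin s → α) → ℝ≥0∞) u ≤
      ENNReal.ofReal (Real.exp (-(d / 2 * (s * d)))) *
        ∏ t, ENNReal.ofReal (Real.exp (d / 2 * X t (u t))) := by
    intro u
    by_cases hu : s * d ≤ ∑ t, X t (u t)
    · rw [Set.indicator_of_mem (by exact hu),
        ← ENNReal.ofReal_prod_of_nonneg fun t _ => (Real.exp_pos _).le, ← Real.exp_sum,
        ← ENNReal.ofReal_mul (Real.exp_pos _).le, ← Real.exp_add, ← Finset.mul_sum]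
      simp only [Pi.one_apply, ENNReal.one_le_ofReal, Real.one_le_exp_iff]
      nlinarith
    · simp [hu]
  refine (expect_mono _ h1).trans ?_
  rw [expect_const_mul,
    expect_indep_prod (fun _ : Fin s => p) fun t a => ENNReal.ofReal (Real.exp (d / 2 * X t a))]
  have h2 : ∏ t : Fin s, expect p (fun a => ENNReal.ofReal (Real.exp (d / 2 * X t a))) ≤
      ENNReal.ofReal (Real.exp (s * (d / 2) ^ 2)) := by
    refine (Finset.prod_le_prod' fun t _ => expect_exp_le p (hX t) (hm t) (by linarith)
      (by linarith : d / 2 ≤ 1)).trans_eq ?_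
    rw [Finset.prod_const, Finset.card_univ, Fintype.card_fin,
      ← ENNReal.ofReal_pow (Real.exp_pos _).le, ← Real.exp_nat_mul]
  refine (mul_le_mul_right h2 _).trans_eq ?_
  rw [← ENNReal.ofReal_mul (Real.exp_pos _).le, ← Real.exp_add]
  congr 2
  ring

/-! ### The parity of the coins in a vote -/

/-- The parity of the coins of the honest participants in the round of candidate `k`. -/
def coinParity {n : ℕ} (C : Finset (Fin n)) (vote : Fin n → Fin 3) (k : Fin 3) : PMF (ZMod 2) :=
  (indep fun i : {i // i ∉ C} => voteCoin n (vote i.1) k).bind fun p => PMF.pure (∑ i, p i)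

/-- The number of honest participants that vote for `k`. -/
def honestVotes {n : ℕ} (C : Finset (Fin n)) (vote : Fin n → Fin 3) (k : Fin 3) : ℕ :=
  (Finset.univ.filter fun i : Fin n => i ∉ C ∧ vote i = k).card

/-- The nontrivial real character of `ZMod 2`. -/
def sign (b : ZMod 2) : ℝ := if b = 1 then -1 else 1

theorem sign_add (a b : ZMod 2) : sign (a + b) = sign a * sign b := by
  have h : ∀ a : ZMod 2, a = 0 ∨ a = 1 := by decide
  have h2 : (1 : ZMod 2) + 1 = 0 := by decide
  rcases h a with rfl | rfl <;> rcases h b with rfl | rfl <;> simp [sign, h2]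

theorem sign_sum {ι : Type} (s : Finset ι) (f : ι → ZMod 2) :
    sign (∑ i ∈ s, f i) = ∏ i ∈ s, sign (f i) := by
  classical
  induction s using Finset.induction_on with
  | empty => simp [sign]
  | insert i s hi ih => rw [Finset.sum_insert hi, Finset.prod_insert hi, sign_add, ih]

theorem sum_zmod_two {M : Type} [AddCommMonoid M] (f : ZMod 2 → M) : ∑ b, f b = f 0 + f 1 := by
  have h : (Finset.univ : Finset (ZMod 2)) = {0, 1} := by decide
  rw [h, Finset.sum_pair (by decide)]

theorem sum_toReal_mul_bind_pure {α β : Type} [Fintype α] [Fintype β] [DecidableEq β] (p : PMF α)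
    (g : α → β) (f : β → ℝ) :
    ∑ b, ((p.bind fun a => PMF.pure (g a)) b).toReal * f b = ∑ a, (p a).toReal * f (g a) := by
  have h : ∀ b, ((p.bind fun a => PMF.pure (g a)) b).toReal =
      ∑ a, if b = g a then (p a).toReal else 0 := by
    intro b
    rw [PMF.bind_apply, tsum_fintype, ENNReal.toReal_sum]
    · refine Finset.sum_congr rfl fun a _ => ?_
      by_cases hb : b = g a <;> simp [PMF.pure_apply, hb]
    · intro a _
      exact ENNReal.mul_ne_top (p.apply_ne_top a) (PMF.apply_ne_top _ _)
  simp_rw [h, Finset.sum_mul]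
  rw [Finset.sum_comm]
  refine Finset.sum_congr rfl fun a _ => ?_
  simp

theorem sum_toReal_mul_sign_voteCoin {n : ℕ} (hn : 3 ≤ n) (v k : Fin 3) :
    ∑ b, (voteCoin n v k b).toReal * sign b = if v = k then ((n : ℝ) - 2) / n else 1 := by
  have hn0 : (n : ℝ) ≠ 0 := by positivity
  have h01 : (0 : ZMod 2) ≠ 1 := by decide
  rw [sum_zmod_two]
  unfold voteCoin
  split_ifs with h
  · have h1 : ((n : ℝ≥0∞)⁻¹) ≤ 1 := by simpa using by omega
    have hnn : (n : ℝ≥0) ≠ 0 := by positivity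
    simp only [coin, PMF.ofFintype_apply, sign, h01, if_true, if_false]
    rw [ENNReal.coe_inv hnn, ENNReal.coe_natCast, ENNReal.toReal_sub_of_le h1 ENNReal.one_ne_top,
      ENNReal.toReal_inv, ENNReal.toReal_natCast, ENNReal.toReal_one]
    field_simp
    ring
  · simp [sign, PMF.pure_apply, h01]

/-- A character turns the parity into a product, so the expectation factors over the independent
coins. Each vote for `k` contributes `1 - 2/n`, every other vote `1`. -/
theorem sum_toReal_mul_sign_coinParity {n : ℕ} (hn : 3 ≤ n) (C : Finset (Fin n))
    (vote : Fin n → Fin 3) (k : Fin 3) :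
    ∑ b, (coinParity C vote k b).toReal * sign b =
      (((n : ℝ) - 2) / n) ^ honestVotes C vote k := by
  unfold coinParity
  rw [sum_toReal_mul_bind_pure]
  simp_rw [sign_sum, indep_apply, ENNReal.toReal_prod, ← Finset.prod_mul_distrib]
  rw [← Fintype.piFinset_univ, ← Finset.prod_univ_sum
    (fun _ : {i // i ∉ C} => (Finset.univ : Finset (ZMod 2)))
    (fun i b => (voteCoin n (vote i.1) k b).toReal * sign b)]
  simp_rw [sum_toReal_mul_sign_voteCoin hn]
  rw [Finset.prod_ite, Finset.prod_const_one, mul_one, Finset.prod_const, honestVotes]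
  congr 1
  rw [← Finset.card_map (Function.Embedding.subtype _)]
  congr 1
  ext i
  simp [and_comm]

theorem oddProb_eq {n : ℕ} (hn : 3 ≤ n) (v : ℕ) :
    oddProb n v = (1 - (((n : ℝ) - 2) / n) ^ v) / 2 := by
  have h3 : (3 : ℝ) ≤ n := by exact_mod_cast hn
  have h0 : (n : ℝ) - 2 ≠ 0 := by linarith
  have h1 : (n : ℝ) ≠ 0 := by linarith
  unfold oddProb
  have h : (((n : ℝ) - 2) / n) ^ v * ((n : ℝ) / (n - 2)) ^ v = 1 := by
    rw [← mul_pow, div_mul_div_cancel₀ h1, div_self h0, one_pow]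
  rw [mul_sub, mul_assoc, h]
  ring

/-- Total mass and mean sign are two linear equations for the two probabilities. -/
theorem coinParity_toReal {n : ℕ} (hn : 3 ≤ n) (C : Finset (Fin n)) (vote : Fin n → Fin 3)
    (k : Fin 3) :
    (coinParity C vote k 1).toReal = oddProb n (honestVotes C vote k) ∧
    (coinParity C vote k 0).toReal = 1 - oddProb n (honestVotes C vote k) := by
  have h01 : (0 : ZMod 2) ≠ 1 := by decide
  have h1 := sum_toReal_mul_sign_coinParity hn C vote k
  have h2 := sum_toReal_eq_one (coinParity C vote k)
  rw [sum_zmod_two] at h1 h2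
  simp only [sign, h01, if_true, if_false] at h1
  rw [oddProb_eq hn]
  constructor <;> linarith

/-- The upper bound `1/2` is what makes tampering one-sided. -/
theorem oddProb_mem {n : ℕ} (hn : 3 ≤ n) (v : ℕ) : 0 ≤ oddProb n v ∧ oddProb n v ≤ 1 / 2 := by
  have h3 : (3 : ℝ) ≤ n := by exact_mod_cast hn
  have h0 : 0 ≤ ((n : ℝ) - 2) / n := div_nonneg (by linarith) (by linarith)
  have h1 : ((n : ℝ) - 2) / n ≤ 1 := (div_le_one (by linarith)).2 (by linarith)
  have := pow_le_one₀ h0 h1 (n := v)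
  have := pow_nonneg h0 v
  rw [oddProb_eq hn]
  constructor <;> linarith

/-- The fraction of ones in a string of bits. -/
def frequency {s : ℕ} (u : Fin s → ZMod 2) : ℝ := (∑ t, ((u t).val : ℝ)) / s

theorem val_zmod_two : (0 : ZMod 2).val = 0 ∧ (1 : ZMod 2).val = 1 := ⟨rfl, rfl⟩

/-- Adding a fixed string to the parities cannot decrease the fraction of ones substantially. -/
theorem prob_frequency_le {n s : ℕ} (hn : 3 ≤ n) (C : Finset (Fin n)) (vote : Fin n → Fin 3)
    (k : Fin 3) (a : Fin s → ZMod 2) {d : ℝ} (hd : 0 ≤ d) (hd' : d ≤ 1) :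
    (prob (indep fun _ : Fin s => coinParity C vote k) fun u =>
      frequency (a + u) ≤ oddProb n (honestVotes C vote k) - d) ≤
      ENNReal.ofReal (Real.exp (-(d ^ 2 / 4 * s))) := by
  -- For `s = 0` the frequency is the default value of a division by zero, but the claimed bound is
  -- `1`.
  rcases Nat.eq_zero_or_pos s with rfl | hs
  · exact (prob_le_one _ _).trans (by simp)
  obtain ⟨hq1, hq0⟩ := coinParity_toReal hn C vote k
  obtain ⟨hm0, hm1⟩ := oddProb_mem hn (honestVotes C vote k)
  set m := oddProb n (honestVotes C vote k)
  have h : ∀ b : ZMod 2, b = 0 ∨ b = 1 := by decide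
  have h2 : (1 : ZMod 2) + 1 = 0 := by decide
  obtain ⟨v0, v1⟩ := val_zmod_two
  have key := prob_indep_sum_ge_le (s := s) (coinParity C vote k)
    (X := fun t b => m - ((a t + b).val : ℝ)) (fun t b => ?_) (fun t => ?_) hd hd'
  · refine (prob_mono _ fun u hu => ?_).trans key
    have hs' : (0 : ℝ) < s := by exact_mod_cast hs
    unfold frequency at hu
    rw [div_le_iff₀ hs'] at hu
    rw [Finset.sum_sub_distrib, Finset.sum_const, Finset.card_univ, Fintype.card_fin, nsmul_eq_mul]
    simp only [Pi.add_apply] at hu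
    linarith
  · rw [abs_le]
    rcases h (a t + b) with e | e <;> rw [e] <;> simp only [v0, v1, Nat.cast_zero, Nat.cast_one] <;>
      constructor <;> linarith
  -- The mean is `0` if the offset bit is `0`, and `m - (1 - m)`, nonpositive by `m ≤ 1/2`, if it is
  -- `1`.
  · rw [sum_zmod_two, hq0, hq1]
    rcases h (a t) with e | e <;> rw [e] <;>
      simp only [v0, v1, h2, add_zero, zero_add, Nat.cast_zero, Nat.cast_one] <;> nlinarith

/-- Unlike the lower tail, this admits no offset, since an offset can raise the frequency. It serves
the case where everybody is honest. -/
theorem prob_le_frequency {n s : ℕ} (hn : 3 ≤ n) (C : Finset (Fin n)) (vote : Fin n → Fin 3)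
    (k : Fin 3) {d : ℝ} (hd : 0 ≤ d) (hd' : d ≤ 1) :
    (prob (indep fun _ : Fin s => coinParity C vote k) fun u =>
      oddProb n (honestVotes C vote k) + d ≤ frequency u) ≤
      ENNReal.ofReal (Real.exp (-(d ^ 2 / 4 * s))) := by
  rcases Nat.eq_zero_or_pos s with rfl | hs
  · exact (prob_le_one _ _).trans (by simp)
  obtain ⟨hq1, hq0⟩ := coinParity_toReal hn C vote k
  obtain ⟨hm0, hm1⟩ := oddProb_mem hn (honestVotes C vote k)
  set m := oddProb n (honestVotes C vote k)
  have h : ∀ b : ZMod 2, b = 0 ∨ b = 1 := by decide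
  obtain ⟨v0, v1⟩ := val_zmod_two
  have key := prob_indep_sum_ge_le (s := s) (coinParity C vote k)
    (X := fun _ b => (b.val : ℝ) - m) (fun t b => ?_) (fun t => ?_) hd hd'
  · refine (prob_mono _ fun u hu => ?_).trans key
    have hs' : (0 : ℝ) < s := by exact_mod_cast hs
    unfold frequency at hu
    rw [le_div_iff₀ hs'] at hu
    rw [Finset.sum_sub_distrib, Finset.sum_const, Finset.card_univ, Fintype.card_fin, nsmul_eq_mul]
    linarith
  · rw [abs_le]
    rcases h b with e | e <;> rw [e] <;> simp only [v0, v1, Nat.cast_zero, Nat.cast_one] <;>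
      constructor <;> linarith
  · rw [sum_zmod_two, hq0, hq1]
    simp only [v0, v1, Nat.cast_zero, Nat.cast_one]
    nlinarith

/-! ### Decoding -/

/-- A frequency this close to `oddProb n v` can be decoded only into `v`. -/
def margin (n : ℕ) : ℝ := 1 / (10 * Real.exp 1 ^ 2 * n)

/-- With `m = n - 2`, the bound `(1 + 2/m)^m ≤ e²` gives `(1 - 2/n)^(n-2) ≥ e⁻²`. The remaining
factor `1 - 2/n` is at least `6/10` once `n ≥ 5`; the cases `n = 3, 4` are numerical. -/
theorem pow_sub_one_ge {n : ℕ} (hn : 3 ≤ n) :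
    6 / (10 * Real.exp 1 ^ 2) ≤ (((n : ℝ) - 2) / n) ^ (n - 1) := by
  have he : 7.3 < Real.exp 1 ^ 2 := by
    have := Real.exp_one_gt_d9
    nlinarith
  rcases (by omega : n = 3 ∨ n = 4 ∨ 5 ≤ n) with rfl | rfl | h5
  · rw [div_le_iff₀ (by positivity)]
    generalize Real.exp 1 ^ 2 = e at he
    norm_num at he ⊢
    linarith
  · rw [div_le_iff₀ (by positivity)]
    generalize Real.exp 1 ^ 2 = e at he
    norm_num at he ⊢
    linarith
  · obtain ⟨m, rfl⟩ := Nat.exists_eq_add_of_le' (by omega : 2 ≤ n)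
    have hm : (3 : ℝ) ≤ m := by exact_mod_cast (by omega : 3 ≤ m)
    have hm0 : (0 : ℝ) < m := by linarith
    have e1 : ((m + 2 : ℕ) : ℝ) - 2 = m := by push_cast; ring
    rw [e1, show m + 2 - 1 = m + 1 by omega]
    push_cast
    have h1 : ((m + 2 : ℝ) / m) ^ m ≤ Real.exp 1 ^ 2 := by
      have h2 : (m + 2 : ℝ) / m ≤ Real.exp (2 / m) := by
        have := Real.add_one_le_exp (2 / (m : ℝ))
        rw [add_div, div_self hm0.ne']
        linarith
      refine (pow_le_pow_left₀ (by positivity) h2 m).trans_eq ?_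
      rw [← Real.exp_nat_mul, ← Real.exp_nat_mul]
      congr 1
      field_simp
      norm_num
    have h3 : (1 : ℝ) / Real.exp 1 ^ 2 ≤ ((m : ℝ) / (m + 2)) ^ m := by
      rw [← inv_div ((m : ℝ) + 2) m, inv_pow, ← one_div]
      exact one_div_le_one_div_of_le (by positivity) h1
    have h4 : (6 / 10 : ℝ) ≤ m / (m + 2) := by
      rw [le_div_iff₀ (by linarith)]
      linarith
    calc 6 / (10 * Real.exp 1 ^ 2) = 1 / Real.exp 1 ^ 2 * (6 / 10) := by
          field_simp
      _ ≤ ((m : ℝ) / (m + 2)) ^ m * (m / (m + 2)) := by gcongr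
      _ = (m / (m + 2) : ℝ) ^ (m + 1) := (pow_succ _ _).symm

theorem oddProb_mono {n : ℕ} (hn : 3 ≤ n) {v w : ℕ} (h : v ≤ w) : oddProb n v ≤ oddProb n w := by
  have h3 : (3 : ℝ) ≤ n := by exact_mod_cast hn
  have h0 : 0 ≤ ((n : ℝ) - 2) / n := div_nonneg (by linarith) (by linarith)
  have h1 : ((n : ℝ) - 2) / n ≤ 1 := (div_le_one (by linarith)).2 (by linarith)
  have := pow_le_pow_of_le_one h0 h1 h
  rw [oddProb_eq hn, oddProb_eq hn]
  linarith

/-- The gap between `v` and `v + 1` is `(1 - 2/n)^v / n`, smallest at `v = n - 1`. The constant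
`6/10` of `pow_sub_one_ge` splits as `1/10` for `margin` and `5/10` for the decoding radius. -/
theorem margin_add_le {n : ℕ} (hn : 3 ≤ n) {v w : ℕ} (h : v < w) (hw : w ≤ n) :
    margin n + 1 / (2 * Real.exp 1 ^ 2 * n) ≤ oddProb n w - oddProb n v := by
  have h3 : (3 : ℝ) ≤ n := by exact_mod_cast hn
  have h0 : 0 ≤ ((n : ℝ) - 2) / n := div_nonneg (by linarith) (by linarith)
  have h1 : ((n : ℝ) - 2) / n ≤ 1 := (div_le_one (by linarith)).2 (by linarith)
  have hn0 : (n : ℝ) ≠ 0 := by linarith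
  have hp := pow_sub_one_ge hn
  have hv : (((n : ℝ) - 2) / n) ^ (n - 1) ≤ (((n : ℝ) - 2) / n) ^ v :=
    pow_le_pow_of_le_one h0 h1 (by omega)
  have hm := oddProb_mono hn (show v + 1 ≤ w from h)
  have hs : oddProb n (v + 1) - oddProb n v = (((n : ℝ) - 2) / n) ^ v / n := by
    rw [oddProb_eq hn, oddProb_eq hn, pow_succ]
    field_simp
    ring
  have he : margin n + 1 / (2 * Real.exp 1 ^ 2 * n) = 6 / (10 * Real.exp 1 ^ 2) / n := by
    unfold margin
    field_simp
    norm_num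
  rw [he]
  have := div_le_div_of_nonneg_right (hp.trans hv) (by linarith : (0 : ℝ) ≤ n)
  linarith

theorem margin_pos {n : ℕ} (hn : 3 ≤ n) : 0 < margin n := by
  have : (0 : ℝ) < n := by exact_mod_cast (by omega : 0 < n)
  unfold margin
  positivity

theorem margin_le {n : ℕ} (hn : 3 ≤ n) :
    10 * margin n ≤ 1 ∧ margin n < 1 / (2 * Real.exp 1 ^ 2 * n) := by
  have h3 : (3 : ℝ) ≤ n := by exact_mod_cast hn
  have he : 1 ≤ Real.exp 1 ^ 2 := one_le_pow₀ (Real.one_le_exp (by norm_num))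
  unfold margin
  constructor
  · rw [mul_one_div, div_le_one (by positivity)]
    nlinarith
  · refine one_div_lt_one_div_of_lt (by positivity) ?_
    have : 0 < Real.exp 1 ^ 2 * n := by positivity
    linarith

/-- A frequency that is not much below `oddProb n v` is not decoded into a number below `v`. -/
theorem IsDecoder.le_of_lt {n : ℕ} {dec : ℝ → Option ℕ} (hdec : IsDecoder n dec) (hn : 3 ≤ n)
    {v w : ℕ} (hv : v ≤ n) {x : ℝ} (hx : oddProb n v - margin n < x) (hw : dec x = some w) :
    v ≤ w := by
  by_contra! h
  have h1 := (abs_lt.1 ((hdec x).1 w hw).2).2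
  have h2 := margin_add_le hn h hv
  linarith

/-- The value `v` itself qualifies because `margin n` is below the radius, and the gaps exclude all
others on both sides. Hence the rule for breaking ties is irrelevant. -/
theorem IsDecoder.eq_some {n : ℕ} {dec : ℝ → Option ℕ} (hdec : IsDecoder n dec) (hn : 3 ≤ n)
    {v : ℕ} (hv : v ≤ n) {x : ℝ} (hx : oddProb n v - margin n < x)
    (hx' : x < oddProb n v + margin n) : dec x = some v := by
  cases hw : dec x with
  | none =>
    refine absurd ?_ ((hdec x).2 hw v hv)
    have := (margin_le hn).2
    rw [abs_lt]
    constructor <;> linarith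
  | some w =>
    have h1 := hdec.le_of_lt hn hv hx hw
    obtain ⟨hwn, h2⟩ := (hdec x).1 w hw
    rcases h1.eq_or_lt with rfl | h
    · rfl
    · have h3 := margin_add_le hn h hwn
      have h4 := (abs_lt.1 h2).1
      linarith

/-! ### Parity -/

section parity

variable {n s : ℕ} {C : Finset (Fin n)}

theorem card_parityStrings (i : Fin n) (x : ZMod 2) :
    (parityStrings n x).card = (parityStrings n 0).card := by
  refine (Finset.card_bij' (fun r _ => r + Pi.single i x) (fun r _ => r - Pi.single i x)
    (fun r hr => ?_) (fun r hr => ?_) (fun r _ => ?_) fun r _ => ?_).symm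
  · simp only [parityStrings, Finset.mem_filter, Finset.mem_univ, true_and] at hr ⊢
    simp [Finset.sum_add_distrib, hr]
  · simp only [parityStrings, Finset.mem_filter, Finset.mem_univ, true_and] at hr ⊢
    simp [Finset.sum_sub_distrib, hr]
  · simp
  · simp

/-- Translation by `x` at position `i` carries the even strings bijectively onto those of parity
`x`, and both distributions are uniform. -/
theorem shareString_add_single (i : Fin n) (x : ZMod 2) (r : Fin n → ZMod 2) :
    shareString i x (r + Pi.single i x) = shareString i 0 r := by
  have h : r + Pi.single i x ∈ parityStrings n x ↔ r ∈ parityStrings n 0 := by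
    simp [parityStrings, Finset.sum_add_distrib]
  simp only [shareString, PMF.uniformOfFinset_apply, h, card_parityStrings i x]
  split_ifs <;> rfl

/-- Changing the inputs of the honest participants shifts the bits they hold after the private part of
parity, and changes nothing else. -/
theorem expect_parityShares (A : Adversary n s C) (p : {i // i ∉ C} → ZMod 2) (st : A.State)
    (F : A.State × ({i // i ∉ C} → ZMod 2) → ℝ≥0∞) :
    expect (parityShares A p st) F =
      expect (parityShares A 0 st) fun x => F (x.1, x.2 + p) := by
  unfold parityShares
  simp_rw [expect_bind, expect_pure]
  -- The coupling: `p i` is added to the bit that participant `i` keeps for itself.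
  rw [← expect_equiv (indep fun i : {i // i ∉ C} => shareString i.1 0)
    (indep fun i : {i // i ∉ C} => shareString i.1 (p i))
    (Equiv.addRight fun i : {i // i ∉ C} => Pi.single i.1 (p i)) fun r => by
      rw [indep_apply, indep_apply]
      exact Finset.prod_congr rfl fun i _ => (shareString_add_single i.1 (p i) (r i)).symm]
  refine congrArg _ (funext fun r => ?_)
  -- Bits sent to corrupt participants are untouched, so the adversary acts identically in both
  -- runs.
  have h1 : ∀ (i : {i // i ∉ C}) (j : {j // j ∈ C}),
      (Pi.single i.1 (p i) : Fin n → ZMod 2) j.1 = 0 := fun i j =>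
    Pi.single_eq_of_ne (fun h : j.1 = i.1 => i.2 (h ▸ j.2)) _
  have h2 : ∀ l : {i // i ∉ C}, (∑ i : Fin n, if h : i ∈ C then (0 : ZMod 2) else
      (Pi.single i (p ⟨i, h⟩) : Fin n → ZMod 2) l.1) = p l := by
    intro l
    rw [Finset.sum_eq_single l.1]
    · simp [l.2]
    · intro i _ hi
      by_cases h : i ∈ C
      · simp [h]
      · simp [h, Pi.single_eq_of_ne hi.symm]
    · simp
  simp only [Equiv.coe_addRight, Pi.add_apply, h1, add_zero]
  refine congrArg _ (funext fun a => congrArg _ (Prod.ext rfl (funext fun l => ?_)))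
  simp only [Pi.add_apply]
  rw [← h2 l, ← Finset.sum_add_distrib]
  refine Finset.sum_congr rfl fun i _ => ?_
  by_cases h : i ∈ C <;> simp [h]

theorem prob_shareString (i : Fin n) (x : ZMod 2) :
    (prob (shareString i x) fun r => ∑ j, r j ≠ x) = 0 := by
  unfold prob expect
  rw [ENNReal.tsum_eq_zero]
  intro r
  by_cases h : ∑ j, r j = x
  · simp [h]
  · simp [h, shareString, parityStrings]

theorem prob_eq_zero_of_forall {α : Type} (p : PMF α) {S : α → Prop} (h : ∀ a, ¬ S a) :
    prob p S = 0 :=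
  le_antisymm (expect_le p fun a => by simp [h a]) zero_le

/-- If all participants are honest, the outcome of parity with zero inputs is zero. -/
theorem prob_sum_parityShares_ne_zero (A : Adversary n s ∅) (st : A.State) :
    (prob (parityShares A 0 st) fun x => ∑ i, x.2 i ≠ 0) = 0 := by
  refine le_antisymm ?_ zero_le
  unfold parityShares
  refine (prob_bind_le_add (T := fun r => ∃ i, ∑ j, r i j ≠ 0) (c := 0) fun r hr => ?_).trans ?_
  · rw [prob_bind_pure]
    refine (prob_eq_zero_of_forall _ fun a => ?_).le
    simp only [Finset.notMem_empty, dite_false, not_not]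
    push Not at hr
    -- Summing the share matrix by rows instead of columns: every row has even parity.
    rw [Finset.sum_comm]
    refine Finset.sum_eq_zero fun i _ => ?_
    rw [← hr ⟨i, Finset.notMem_empty i⟩]
    exact Fintype.sum_equiv (Equiv.subtypeUnivEquiv fun i => Finset.notMem_empty i) _ _
      fun _ => rfl
  · rw [add_zero]
    refine (prob_exists_le _ _).trans (Finset.sum_eq_zero fun i _ => ?_).le
    exact (expect_indep_eval _ i (Set.indicator {r : Fin n → ZMod 2 | ∑ j, r j ≠ 0} 1)).trans
      (prob_shareString i.1 0)

end parity

/-! ### The vote -/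

section vote

variable {n s : ℕ} {C : Finset (Fin n)}

/-- The private part of parity with zero inputs, and the parity of the bits that the honest
participants hold afterwards. -/
def blankRound (A : Adversary n s C) (st : A.State) : PMF (A.State × ZMod 2) :=
  (parityShares A 0 st).bind fun x => PMF.pure (x.1, ∑ i, x.2 i)

/-- The first phase of the vote with blank inputs. -/
def blankPhase (A : Adversary n s C) (st : A.State) : PMF (A.State × (Fin 3 → Fin s → ZMod 2)) :=
  loop 3 (fun _ => loop s fun _ st' => blankRound A st') st

/-- The parities of the coins of the honest participants in all rounds of the vote. -/
def coinParities (s : ℕ) (C : Finset (Fin n)) (vote : Fin n → Fin 3) :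
    PMF (Fin 3 → Fin s → ZMod 2) :=
  indep fun k => indep fun _ => coinParity C vote k

/-- The parities of the bits that the honest participants store are masked by coins that are
independent of everything that the adversary sees. -/
theorem expect_votePhase (A : Adversary n s C) (vote : Fin n → Fin 3) (st : A.State)
    (F : A.State → (Fin 3 → Fin s → ZMod 2) → ℝ≥0∞) :
    (expect (votePhase A vote st) fun x => F x.1 fun k t => ∑ i, x.2 k t i) =
      expect (blankPhase A st) fun x =>
        expect (coinParities s C vote) fun u => F x.1 (x.2 + u) := by
  unfold votePhase blankPhase coinParities
  refine expect_loop_add_noise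
    (fun (z : Fin s → {i // i ∉ C} → ZMod 2) (t : Fin s) => ∑ i, z t i) _
    (fun _ => loop s fun _ st' => blankRound A st')
    (fun k => indep fun _ => coinParity C vote k) (fun k st F => ?_) st F
  refine expect_loop_add_noise (fun z : {i // i ∉ C} → ZMod 2 => ∑ i, z i) _ _ _
    (fun _ st F => ?_) st F
  unfold blankRound coinParity
  simp_rw [expect_bind, expect_pure]
  -- The blank run does not involve the coins, so they may be drawn first; then
  -- `expect_parityShares` applies for each fixed `p`.
  rw [expect_comm]
  refine congrArg _ (funext fun p => ?_)
  rw [expect_parityShares]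
  simp only [Pi.add_apply, Finset.sum_add_distrib]

theorem prob_blankPhase_ne_zero (A : Adversary n s ∅) (st : A.State) :
    (prob (blankPhase A st) fun x => ∃ k t, x.2 k t ≠ 0) = 0 := by
  refine le_antisymm ?_ zero_le
  refine (prob_loop_exists_le _ (fun _ (w : Fin s → ZMod 2) => ∃ t, w t ≠ 0) (fun _ => 0) (fun _ st => ?_) st).trans
    (by simp)
  refine (prob_loop_exists_le _ (fun _ (w : ZMod 2) => w ≠ 0) (fun _ => 0) (fun _ st => ?_) st).trans
    (by simp)
  unfold blankRound
  rw [prob_bind_pure]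
  exact (prob_sum_parityShares_ne_zero A st).le

theorem sum_honestVotes_add_card (C : Finset (Fin n)) (vote : Fin n → Fin 3) :
    ∑ k, honestVotes C vote k + C.card = n := by
  have h : ∑ k, honestVotes C vote k = Cᶜ.card := by
    rw [Finset.card_eq_sum_card_fiberwise (f := vote) (t := Finset.univ) (by simp)]
    refine Finset.sum_congr rfl fun k _ => ?_
    unfold honestVotes
    congr 1
    ext i
    simp
  rw [h, Finset.card_compl_add_card, Fintype.card_fin]

theorem honestVotes_le (C : Finset (Fin n)) (vote : Fin n → Fin 3) (k : Fin 3) :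
    honestVotes C vote k ≤ n :=
  (Finset.card_le_univ _).trans_eq (Fintype.card_fin n)

/-- A bound on the probability that one frequency deviates in one direction. -/
def tail (n s : ℕ) : ℝ≥0∞ := ENNReal.ofReal (Real.exp (-(margin n ^ 2 / 4 * s)))

theorem prob_coinParities_low (hn : 3 ≤ n) (vote : Fin n → Fin 3) (a : Fin 3 → Fin s → ZMod 2) :
    (prob (coinParities s C vote) fun u => ∃ k,
      frequency (a k + u k) ≤ oddProb n (honestVotes C vote k) - margin n) ≤ 3 * tail n s := by
  have hm := margin_pos hn
  have hm' := (margin_le hn).1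
  refine (prob_exists_le _ _).trans ((Finset.sum_le_sum fun k _ => ?_).trans_eq
    (b := ∑ _k : Fin 3, tail n s) (by simp))
  exact (expect_indep_eval _ k (Set.indicator {u | frequency (a k + u) ≤ _} 1)).trans_le
    (prob_frequency_le hn C vote k (a k) hm.le (by linarith))

theorem prob_coinParities_high (hn : 3 ≤ n) (vote : Fin n → Fin 3) :
    (prob (coinParities s C vote) fun u => ∃ k,
      oddProb n (honestVotes C vote k) + margin n ≤ frequency (u k)) ≤ 3 * tail n s := by
  have hm := margin_pos hn
  have hm' := (margin_le hn).1
  refine (prob_exists_le _ _).trans ((Finset.sum_le_sum fun k _ => ?_).trans_eq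
    (b := ∑ _k : Fin 3, tail n s) (by simp))
  exact (expect_indep_eval _ k (Set.indicator {u | _ ≤ frequency u} 1)).trans_le
    (prob_le_frequency hn C vote k hm.le (by linarith))

theorem tally_eq_some {dec : ℝ → Option ℕ} {w : Fin n → Option (Strings s)} {y : Fin 3 → ℕ} :
    tally dec w = some y ↔ (∀ i, w i ≠ none) ∧
      (∀ k, dec (frequency fun t => ∑ i, (w i).getD 0 k t) = some (y k)) ∧ ∑ k, y k = n := by
  have e : ∀ k, oddFrequency (fun i => (w i).getD 0) k =
      frequency fun t => ∑ i, (w i).getD 0 k t := fun _ => rfl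
  unfold tally
  simp only [e]
  constructor
  · intro h
    split_ifs at h with hc
    obtain ⟨h1, h2, h3⟩ := hc
    obtain rfl := Option.some.inj h
    refine ⟨h1, fun k => ?_, h3⟩
    obtain ⟨v, hv⟩ := Option.ne_none_iff_exists'.1 (h2 k)
    simp only [hv, Option.getD_some]
  · rintro ⟨h1, h2, h3⟩
    rw [if_pos ⟨h1, fun k => by simp [h2], by simp [h2, h3]⟩]
    simp [h2]

/-- The parities of the strings that the corrupt participants send to the receiver. -/
def corruptParity (b : {i // i ∈ C} → Option (Strings s)) : Fin 3 → Fin s → ZMod 2 :=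
  fun k t => ∑ i, (b i).getD 0 k t

theorem sum_strings (b : {i // i ∈ C} → Option (Strings s))
    (z : Fin 3 → Fin s → {i // i ∉ C} → ZMod 2) (k : Fin 3) :
    (fun t => ∑ i : Fin n, (if h : i ∈ C then b ⟨i, h⟩ else some fun k t => z k t ⟨i, h⟩).getD 0 k t) =
      corruptParity b k + fun t => ∑ i, z k t i := by
  funext t
  rw [← Fintype.sum_subtype_add_sum_subtype (fun i => i ∈ C), Pi.add_apply, corruptParity]
  congr 1
  · exact Finset.sum_congr (by ext; simp) fun i _ => by simp [i.2]
  · exact Finset.sum_congr (by ext; simp) fun i _ => by simp [i.2]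

/-- The tally of an honest receiver is consistent with the honest votes, or it aborts. -/
theorem prob_voteFor_inconsistent (hn : 3 ≤ n) (A : Adversary n s C) {dec : ℝ → Option ℕ}
    (hdec : IsDecoder n dec) (vote : Fin n → Fin 3) {j : Fin n} (hj : j ∉ C) (st : A.State) :
    (prob (voteFor A dec vote j st) fun x => ∃ y, x.2 = some y ∧
      ¬ (∑ k, y k = n ∧ ∀ k, honestVotes C vote k ≤ y k)) ≤ 3 * tail n s := by
  unfold voteFor
  simp only [if_neg hj]
  -- The bad event is enlarged to one that depends on the honest bits only through their sums, the
  -- form required by `expect_votePhase`.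
  have key : ∀ a : A.State × (Fin 3 → Fin s → {i // i ∉ C} → ZMod 2),
      (prob (A.sendStrings a.1) fun b => ∃ y,
        (tally dec fun i => if h : i ∈ C then b.2 ⟨i, h⟩ else some fun k t => a.2 k t ⟨i, h⟩) =
          some y ∧ ¬ (∑ k, y k = n ∧ ∀ k, honestVotes C vote k ≤ y k)) ≤
      (fun st' (H : Fin 3 → Fin s → ZMod 2) => prob (A.sendStrings st') fun b => ∃ k,
        frequency (corruptParity b.2 k + H k) ≤ oddProb n (honestVotes C vote k) - margin n)
        a.1 (fun k t => ∑ i, a.2 k t i) := by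
    intro a
    refine prob_mono _ fun b hb => ?_
    obtain ⟨y, hy, hn'⟩ := hb
    obtain ⟨-, h2, h3⟩ := tally_eq_some.1 hy
    by_contra! hlt
    refine hn' ⟨h3, fun k => ?_⟩
    have h4 := h2 k
    rw [sum_strings] at h4
    exact hdec.le_of_lt hn (honestVotes_le C vote k) (hlt k) h4
  rw [prob_bind]
  refine (expect_mono _ fun a => ?_).trans ((expect_votePhase A vote st (fun st' H =>
    prob (A.sendStrings st') fun b => ∃ k, frequency (corruptParity b.2 k + H k) ≤
      oddProb n (honestVotes C vote k) - margin n)).trans_le ?_)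
  · rw [prob_bind_pure]
    exact key a
  · refine expect_le _ fun x => ?_
    unfold prob
    -- The adversary's strings depend on the state but not on the coins. With them fixed, their
    -- parity and the blank value form the constant offset.
    rw [expect_comm]
    refine expect_le _ fun b => ?_
    refine (prob_mono _ fun u hu => ?_).trans
      (prob_coinParities_low hn vote (corruptParity b.2 + x.2))
    simpa [add_assoc] using hu

/-- If all participants are honest, the tally yields the numbers of votes. -/
theorem prob_voteFor_ne (hn : 3 ≤ n) (A : Adversary n s ∅) {dec : ℝ → Option ℕ}
    (hdec : IsDecoder n dec) (vote : Fin n → Fin 3) (j : Fin n) (st : A.State) :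
    (prob (voteFor A dec vote j st) fun x => x.2 ≠ some (honestVotes ∅ vote)) ≤
      6 * tail n s := by
  unfold voteFor
  simp only [if_neg (Finset.notMem_empty j)]
  rw [prob_bind]
  refine (expect_mono _ fun a => ?_).trans ((expect_votePhase A vote st (fun _ =>
    Set.indicator {H | ∃ k, frequency (H k) ≤ oddProb n (honestVotes ∅ vote k) - margin n ∨
      oddProb n (honestVotes ∅ vote k) + margin n ≤ frequency (H k)} 1)).trans_le ?_)
  · rw [prob_bind_pure]
    by_cases hH : ∃ k, frequency (fun t => ∑ i, a.2 k t i) ≤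
        oddProb n (honestVotes ∅ vote k) - margin n ∨
      oddProb n (honestVotes ∅ vote k) + margin n ≤ frequency (fun t => ∑ i, a.2 k t i)
    · rw [Set.indicator_of_mem (by exact hH)]
      exact prob_le_one _ _
    · refine (prob_eq_zero_of_forall _ fun b => ?_).trans_le zero_le
      push Not at hH ⊢
      refine tally_eq_some.2 ⟨fun i => by simp, fun k => ?_, ?_⟩
      · rw [sum_strings]
        have h0 : corruptParity b.2 k = 0 := funext fun t => by simp [corruptParity]
        rw [h0, zero_add]
        exact hdec.eq_some hn (honestVotes_le ∅ vote k) (hH k).1 (hH k).2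
      · simpa using sum_honestVotes_add_card ∅ vote
  · have h6 : ∀ x : A.State × (Fin 3 → Fin s → ZMod 2),
        (expect (coinParities s ∅ vote) fun u =>
          Set.indicator {H : Fin 3 → Fin s → ZMod 2 |
            ∃ k, frequency (H k) ≤ oddProb n (honestVotes ∅ vote k) - margin n ∨
              oddProb n (honestVotes ∅ vote k) + margin n ≤ frequency (H k)} 1 (x.2 + u)) ≤
        Set.indicator {x : A.State × (Fin 3 → Fin s → ZMod 2) | ∃ k t, x.2 k t ≠ 0} 1 x +
          6 * tail n s := by
      intro x
      by_cases hx : ∃ k t, x.2 k t ≠ 0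
      · exact (prob_le_one _ fun u => (x.2 + u) ∈ {H : Fin 3 → Fin s → ZMod 2 | _}).trans
          (by simp [hx])
      · push Not at hx
        have h0 : x.2 = 0 := funext fun k => funext fun t => hx k t
        simp only [h0, zero_add]
        have h63 : 6 * tail n s = 3 * tail n s + 3 * tail n s := by ring
        refine le_trans ?_ le_add_self
        rw [h63]
        refine le_trans ?_ (add_le_add (prob_coinParities_low (C := ∅) hn vote 0)
          (prob_coinParities_high (C := ∅) hn vote))
        refine (prob_mono _ fun u hu => ?_).trans (prob_or_le _ _ _)
        obtain ⟨k, hk | hk⟩ := hu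
        · exact Or.inl ⟨k, by simpa using hk⟩
        · exact Or.inr ⟨k, hk⟩
    refine (expect_mono _ h6).trans ?_
    rw [expect_add, expect_const]
    exact (congrArg (· + _) (prob_blankPhase_ne_zero A st)).trans_le (by simp)

end vote

/-! ### The veto -/

section veto

variable {n s : ℕ} {C : Finset (Fin n)}

/-- The broadcasts in one repetition of the veto, in the ordering `o`, if the honest participants hold
the bits `z`. -/
def broadcasts (A : Adversary n s C) (o : Equiv.Perm (Fin n)) (z : {i // i ∉ C} → ZMod 2)
    (st : A.State) : PMF (A.State × (Fin n → Option (ZMod 2))) :=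
  loop n (fun t st' =>
    if h : o t ∈ C then A.speak st' ⟨o t, h⟩
    else (A.hear st' ⟨o t, h⟩ (z ⟨o t, h⟩)).bind fun st'' =>
      PMF.pure (st'', some (z ⟨o t, h⟩))) st

/-- The repetition of the veto with broadcasts `b` does not lead to an abort. -/
def Passes (b : Fin n → Option (ZMod 2)) : Prop :=
  ¬ ((∃ t, b t = none) ∨ ∑ t, (b t).getD 0 = 1)

/-- The outcome is a sum, so flipping the last bit turns outcome `0` into `1`. -/
theorem not_passes_snoc {m : ℕ} (b : Fin m → Option (ZMod 2)) {u : ZMod 2}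
    (h : Passes (Fin.snoc b (some u) : Fin (m + 1) → Option (ZMod 2))) :
    ¬ Passes (Fin.snoc b (some (u + 1)) : Fin (m + 1) → Option (ZMod 2)) := by
  have h2 : ∀ v u : ZMod 2, v + u ≠ 1 → v + (u + 1) = 1 := by decide
  intro h'
  unfold Passes at h h'
  push Not at h h'
  simp only [Fin.sum_univ_castSucc, Fin.snoc_castSucc, Fin.snoc_last, Option.getD_some] at h h'
  exact h'.2 (h2 _ _ h.2)

/-- If the last speaker is honest, flipping its bit turns every passing repetition into an abort. -/
theorem prob_passes_add_le (A : Adversary n s C) (o : Equiv.Perm (Fin n)) {l : Fin n}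
    (hl : (l : ℕ) + 1 = n) (hj : o l ∉ C) (z : {i // i ∉ C} → ZMod 2) (st : A.State) :
    (prob (broadcasts A o z st) fun b => Passes b.2) +
      (prob (broadcasts A o (z + Pi.single ⟨o l, hj⟩ 1) st) fun b => Passes b.2) ≤ 1 := by
  obtain ⟨m, rfl⟩ : ∃ m, n = m + 1 := ⟨l, hl.symm⟩
  obtain rfl : l = Fin.last m := Fin.ext (by simpa using hl)
  have key : ∀ z : {i // i ∉ C} → ZMod 2, (prob (broadcasts A o z st) fun b => Passes b.2) =
      expect (loop m (fun t st' => if h : o t.castSucc ∈ C then A.speak st' ⟨o t.castSucc, h⟩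
        else (A.hear st' ⟨o t.castSucc, h⟩ (z ⟨o t.castSucc, h⟩)).bind fun st'' =>
          PMF.pure (st'', some (z ⟨o t.castSucc, h⟩))) st)
        (Set.indicator {a | Passes (Fin.snoc a.2 (some (z ⟨o (Fin.last m), hj⟩)) :
          Fin (m + 1) → Option (ZMod 2))} 1) := by
    intro z
    unfold broadcasts
    rw [loop_snoc, prob_bind]
    refine congrArg _ (funext fun a => ?_)
    rw [prob_bind_pure, dif_neg hj, prob_bind_pure]
    exact expect_const _ (Set.indicator {a : A.State × (Fin m → Option (ZMod 2)) |
      Passes (Fin.snoc a.2 (some (z ⟨o (Fin.last m), hj⟩)) : Fin (m + 1) → Option (ZMod 2))} 1 a)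
  -- Earlier speakers differ from the last one, so both runs have the same law up to the last
  -- broadcast.
  have hsame : ∀ t : Fin m, ∀ h : o t.castSucc ∉ C,
      (z + Pi.single ⟨o (Fin.last m), hj⟩ 1 : {i // i ∉ C} → ZMod 2) ⟨o t.castSucc, h⟩ = z ⟨o t.castSucc, h⟩ := by
    intro t h
    have hne : (⟨o t.castSucc, h⟩ : {i // i ∉ C}) ≠ ⟨o (Fin.last m), hj⟩ := by
      intro e
      exact (Fin.castSucc_lt_last t).ne (o.injective (congrArg Subtype.val e))
    rw [Pi.add_apply, Pi.single_eq_of_ne hne, add_zero]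
  rw [key, key]
  simp only [hsame]
  simp only [Pi.add_apply, Pi.single_eq_same]
  rw [← expect_add]
  refine expect_le _ fun a => ?_
  by_cases h : Passes (Fin.snoc a.2 (some (z ⟨o (Fin.last m), hj⟩)) :
    Fin (m + 1) → Option (ZMod 2))
  · have h' := not_passes_snoc a.2 h
    simp [h, h']
  · rw [Set.indicator_of_notMem (by exact h), zero_add]
    exact Set.indicator_le_self' (by simp) a

/-- The private part becomes a blank run, so the coins enter only as a shift of the bits to be
announced. -/
theorem prob_vetoRound_eq (A : Adversary n s C) (input : Fin n → Bool) (o : Equiv.Perm (Fin n))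
    (st : A.State) :
    (prob (vetoRound A input o st) fun x => x.2 = false) =
      expect (indep fun i : {i // i ∉ C} => vetoCoin (input i.1)) fun p =>
        expect (parityShares A 0 st) fun a =>
          prob (broadcasts A o (a.2 + p) a.1) fun b => Passes b.2 := by
  unfold vetoRound
  rw [prob_bind]
  refine congrArg _ (funext fun p => ?_)
  rw [prob_bind, expect_parityShares]
  refine congrArg _ (funext fun a => ?_)
  rw [prob_bind_pure]
  simp only [decide_eq_false_iff_not]
  rfl

theorem vetoCoin_true_add (b c : ZMod 2) : vetoCoin true (b + c) = vetoCoin true b := by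
  have h : ∀ b, vetoCoin true b = 2⁻¹ := by
    intro b
    simp only [vetoCoin, if_true, coin, PMF.ofFintype_apply]
    split_ifs
    · rfl
    · exact ENNReal.one_sub_inv_two
  rw [h, h]

/-- If the last speaker is honest and objects, a repetition passes with probability at most one
half. -/
theorem prob_vetoRound_le (A : Adversary n s C) {input : Fin n → Bool} {o : Equiv.Perm (Fin n)}
    {l : Fin n} (hl : (l : ℕ) + 1 = n) (hj : o l ∉ C) (hin : input (o l) = true) (st : A.State) :
    (prob (vetoRound A input o st) fun x => x.2 = false) ≤ 2⁻¹ := by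
  rw [prob_vetoRound_eq]
  set T : ({i // i ∉ C} → ZMod 2) → ℝ≥0∞ := fun p => expect (parityShares A 0 st) fun a =>
    prob (broadcasts A o (a.2 + p) a.1) fun b => Passes b.2 with hT
  set e : ({i // i ∉ C} → ZMod 2) := Pi.single ⟨o l, hj⟩ 1 with he
  have h1 : ∀ p, T p + T (p + e) ≤ 1 := by
    intro p
    simp only [hT]
    rw [← expect_add]
    refine expect_le _ fun a => ?_
    rw [← add_assoc]
    exact prob_passes_add_le A o hl hj (a.2 + p) a.1
  -- The objector's coin is fair, so flipping it preserves the law of the coins. Averaging `h1` then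
  -- bounds twice the passing probability by `1`.
  have h2 : (expect (indep fun i : {i // i ∉ C} => vetoCoin (input i.1)) fun p => T (p + e)) =
      expect (indep fun i : {i // i ∉ C} => vetoCoin (input i.1)) T := by
    refine expect_equiv _ _ (Equiv.addRight e) (fun p => ?_) T
    rw [indep_apply, indep_apply]
    refine Finset.prod_congr rfl fun i _ => ?_
    by_cases hi : i = ⟨o l, hj⟩
    · subst hi
      rw [hin]
      exact (vetoCoin_true_add _ _).symm
    · simp [he, hi]
  have h3 := expect_le (indep fun i : {i // i ∉ C} => vetoCoin (input i.1)) h1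
  rw [expect_add, h2, ← two_mul] at h3
  rw [← one_mul (2⁻¹ : ℝ≥0∞), ← div_eq_mul_inv]
  exact ENNReal.le_div_iff_mul_le (by simp) (by simp) |>.2 (by rwa [mul_comm])

/-- If an honest participant objects, the veto passes with probability at most `2⁻¹ ^ s`. -/
theorem prob_veto_eq_false_le (A : Adversary n s C) {ord : Fin n → Equiv.Perm (Fin n)}
    (hord : IsOrderings ord) {input : Fin n → Bool} {j : Fin n} (hj : j ∉ C)
    (hin : input j = true) (st : A.State) :
    (prob (veto A ord input st) fun x => x.2 = false) ≤ 2⁻¹ ^ s := by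
  have hl : ((⟨n - 1, by have := j.2; omega⟩ : Fin n) : ℕ) + 1 = n := by
    have := j.2
    simp only
    omega
  generalize (⟨n - 1, by have := j.2; omega⟩ : Fin n) = l at hl
  -- There are `n` orderings with distinct last speakers, so by finiteness every participant speaks
  -- last in one of them.
  obtain ⟨a, ha⟩ : ∃ a, ord a l = j :=
    Finite.surjective_of_injective (f := fun a => ord a l) (fun a b h => hord a b l hl h) j
  subst ha
  unfold veto
  rw [prob_bind_pure]
  simp only [decide_eq_false_iff_not]
  push Not
  refine (prob_mono _ fun b hb => ?_).trans ((prob_loop_forall_le _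
    -- Only the ordering ending with the objector is used; the others get the trivial bound `1`.
    (fun _ (w : Fin s → Bool) => ∀ t, w t = false) (fun a' => if a' = a then 2⁻¹ ^ s else 1)
    (fun a' st' => ?_) st).trans_eq ?_)
  · intro a' t
    simpa using hb a' t
  · split_ifs with h
    · subst h
      refine (prob_loop_forall_le _ (fun _ w => w = false) (fun _ => 2⁻¹)
        (fun _ st'' => prob_vetoRound_le A hl hj hin st'') st').trans_eq ?_
      simp
    · exact prob_le_one _ _
  · simp

/-- If all participants are honest and nobody objects, the veto passes. -/
theorem prob_veto_eq_true (A : Adversary n s ∅) (ord : Fin n → Equiv.Perm (Fin n))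
    {input : Fin n → Bool} (hin : ∀ j, input j = false) (st : A.State) :
    (prob (veto A ord input st) fun x => x.2 = true) = 0 := by
  refine le_antisymm ?_ zero_le
  unfold veto
  rw [prob_bind_pure]
  simp only [decide_eq_true_eq]
  refine (prob_loop_exists_le _ (fun _ (w : Fin s → Bool) => ∃ t, w t = true) (fun _ => 0)
    (fun a st => ?_) st).trans (by simp)
  refine (prob_loop_exists_le _ (fun _ w => w = true) (fun _ => 0) (fun _ st => ?_) st).trans
    (by simp)
  unfold vetoRound
  refine (prob_bind_le_add (T := fun p => ∃ i, p i ≠ 0) (c := 0) fun p hp => ?_).trans ?_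
  · push Not at hp
    obtain rfl : p = 0 := funext hp
    refine (prob_bind_le_add (T := fun x => ∑ i, x.2 i ≠ 0) (c := 0) fun x hx => ?_).trans
      (by rw [prob_sum_parityShares_ne_zero, add_zero])
    rw [prob_bind_pure]
    simp only [decide_eq_true_eq]
    refine (prob_mono _ fun b hb => ?_).trans ((prob_loop_exists_le _
      (fun t w => w ≠ some (x.2 ⟨ord a t, Finset.notMem_empty _⟩)) (fun _ => 0)
      (fun t st => ?_) x.1).trans (by simp))
    · by_contra! hc
      rcases hb with ⟨t, ht⟩ | hb
      · simp [hc t] at ht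
      · simp only [hc, Option.getD_some] at hb
        refine absurd (hb.symm.trans ?_) (by decide : (1 : ZMod 2) ≠ 0)
        rw [← not_not.1 hx]
        exact Fintype.sum_equiv ((ord a).trans
          (Equiv.subtypeUnivEquiv fun i => Finset.notMem_empty i).symm) _ _ fun _ => rfl
    · rw [dif_neg (Finset.notMem_empty _), prob_bind_pure]
      exact (prob_eq_zero_of_forall _ fun _ => by simp).le
  · rw [add_zero]
    refine (prob_exists_le _ _).trans (Finset.sum_eq_zero fun i _ => ?_).le
    refine (expect_indep_eval _ i (Set.indicator {b : ZMod 2 | b ≠ 0} 1)).trans ?_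
    rw [hin]
    exact prob_pure_of_not (S := fun b : ZMod 2 => b ≠ 0) (by simp)

end veto

/-! ### Anonymous bit transmission -/

section transmission

variable {n s : ℕ} {C : Finset (Fin n)}

/-- By cardinality, `ι` is in bijection with the disjoint union of the `Fin (d k)`; take the
projection to the index. -/
theorem exists_card_fiber {ι : Type} [Fintype ι] {d : Fin 3 → ℕ}
    (h : ∑ k, d k = Fintype.card ι) :
    ∃ f : ι → Fin 3, ∀ k, (Finset.univ.filter fun i => f i = k).card = d k := by
  classical
  have e : ι ≃ Σ k, Fin (d k) := Fintype.equivOfCardEq (by simp [h])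
  refine ⟨fun i => (e i).1, fun k => ?_⟩
  rw [← Fintype.card_subtype, Fintype.card_congr ((e.subtypeEquiv fun i => Iff.rfl).trans
    (Equiv.sigmaSubtype k) : {i // (e i).1 = k} ≃ Fin (d k)), Fintype.card_fin]

/-- A tally that is consistent with the honest votes is the ideal one for some votes of the corrupt
participants. -/
theorem exists_votes {vote : Fin n → Fin 3} {y : Fin 3 → ℕ} (hy : ∑ k, y k = n)
    (h : ∀ k, honestVotes C vote k ≤ y k) :
    ∃ vote' : Fin n → Fin 3, (∀ i, i ∉ C → vote' i = vote i) ∧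
      ∀ k, (Finset.univ.filter fun i => vote' i = k).card = y k := by
  have hs := sum_honestVotes_add_card C vote
  have hd : ∑ k, (y k - honestVotes C vote k) = Fintype.card {i // i ∈ C} := by
    rw [Finset.sum_tsub_distrib _ fun k _ => h k, Fintype.card_coe]
    omega
  obtain ⟨f, hf⟩ := exists_card_fiber hd
  refine ⟨fun i => if hi : i ∈ C then f ⟨i, hi⟩ else vote i, fun i hi => dif_neg hi, fun k => ?_⟩
  rw [← Nat.sub_add_cancel (h k), ← hf k, honestVotes,
    ← Finset.card_map (Function.Embedding.subtype _), ← Finset.card_union_of_disjoint]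
  · congr 1
    ext i
    by_cases hi : i ∈ C <;> simp [hi]
  · rw [Finset.disjoint_left]
    intro i h1 h2
    simp only [Finset.mem_map, Finset.mem_filter, Finset.mem_univ, true_and] at h1 h2
    obtain ⟨⟨i', hi'⟩, -, rfl⟩ := h1
    exact h2.1 hi'

/-- Inputs for different receivers are separate coordinates, so the corrupt votes can be chosen
receiver by receiver and assembled. -/
theorem isCorrect_of_consistent {x : Inputs n} {y : Fin n → Option (Fin 3 → ℕ)}
    (h : ∀ j, j ∉ C → ∃ v, y j = some v ∧ ∑ k, v k = n ∧
      ∀ k, honestVotes C (fun i => x i j) k ≤ v k) :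
    IsCorrect C x (some fun j => (y j).map fun v => (v 0, v 1)) := by
  have h' : ∀ j, ∃ vote' : Fin n → Fin 3, (∀ i, i ∉ C → vote' i = x i j) ∧ (j ∉ C →
      (y j).map (fun v => (v 0, v 1)) = some ((Finset.univ.filter fun i => vote' i = 0).card,
        (Finset.univ.filter fun i => vote' i = 1).card)) := by
    intro j
    by_cases hj : j ∈ C
    · exact ⟨fun i => x i j, fun _ _ => rfl, fun h => absurd hj h⟩
    · obtain ⟨v, hv, hs, hle⟩ := h j hj
      obtain ⟨vote', h1, h2⟩ := exists_votes hs hle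
      exact ⟨vote', h1, fun _ => by simp [hv, h2]⟩
  choose vote' h1 h2 using h'
  exact Or.inr ⟨_, rfl, fun i j => vote' j i, fun i hi => funext fun j => h1 j i hi,
    fun j hj => h2 j hj⟩

theorem prob_transmission_not_isCorrect_le (hn : 3 ≤ n) (A : Adversary n s C)
    {ord : Fin n → Equiv.Perm (Fin n)} (hord : IsOrderings ord) {dec : ℝ → Option ℕ}
    (hdec : IsDecoder n dec) (x : Inputs n) :
    (prob (transmission A ord dec x) fun o => ¬ IsCorrect C x o) ≤
      n * (3 * tail n s) + 2⁻¹ ^ s := by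
  unfold transmission
  -- If no honest tally is inconsistent, incorrectness requires that an honest tally aborted and the
  -- veto nevertheless passed, which costs `2⁻¹ ^ s`.
  refine (prob_bind_le_add (T := fun a => ∃ j, j ∉ C ∧ ∃ y, a.2 j = some y ∧
    ¬ (∑ k, y k = n ∧ ∀ k, honestVotes C (fun i => x i j) k ≤ y k)) (c := 2⁻¹ ^ s)
    fun a ha => ?_).trans (add_le_add_left ?_ _)
  · rw [prob_bind_pure]
    push Not at ha
    by_cases hj : ∃ j, j ∉ C ∧ a.2 j = none
    · obtain ⟨j, hj, hnone⟩ := hj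
      refine (prob_mono _ fun b hb => ?_).trans
        (prob_veto_eq_false_le A hord (input := fun j => (a.2 j).isNone) hj (by simp [hnone]) a.1)
      by_contra hb'
      exact hb (Or.inl (if_pos (by simpa using hb')))
    · push Not at hj
      refine (prob_eq_zero_of_forall _ fun b => ?_).trans_le zero_le
      rw [not_not]
      split_ifs
      · exact Or.inl rfl
      · refine isCorrect_of_consistent fun j hjC => ?_
        obtain ⟨v, hv⟩ := Option.ne_none_iff_exists'.1 (hj j hjC)
        exact ⟨v, hv, ha j hjC v hv⟩
  · refine (prob_loop_exists_le _ (fun j (w : Option (Fin 3 → ℕ)) => j ∉ C ∧ ∃ y, w = some y ∧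
      ¬ (∑ k, y k = n ∧ ∀ k, honestVotes C (fun i => x i j) k ≤ y k)) (fun _ => 3 * tail n s)
      (fun j st => ?_) A.init).trans_eq (by simp)
    by_cases hj : j ∈ C
    · exact (prob_eq_zero_of_forall _ fun _ h => h.1 hj).trans_le zero_le
    · exact (prob_mono _ fun _ h => h.2).trans
        (prob_voteFor_inconsistent hn A hdec (fun i => x i j) hj st)

/-- Once all tallies are right nobody objects and the veto passes almost surely, so only the tallies
contribute to the error. -/
theorem prob_transmission_ne_ideal_le (hn : 3 ≤ n) (A : Adversary n s ∅)
    (ord : Fin n → Equiv.Perm (Fin n)) {dec : ℝ → Option ℕ} (hdec : IsDecoder n dec)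
    (x : Inputs n) :
    (prob (transmission A ord dec x) fun o => o ≠ some fun j => some (ideal x j)) ≤
      n * (6 * tail n s) := by
  unfold transmission
  rw [← add_zero ((n : ℝ≥0∞) * _)]
  refine (prob_bind_le_add (T := fun a => ∃ j, a.2 j ≠ some (honestVotes ∅ fun i => x i j))
    (c := 0) fun a ha => ?_).trans (add_le_add_left ?_ _)
  · rw [prob_bind_pure]
    push Not at ha
    refine (prob_mono _ fun b hb => ?_).trans
      (prob_veto_eq_true A ord (input := fun j => (a.2 j).isNone) (by simp [ha]) a.1).le
    by_contra hb'
    refine hb ((if_neg hb').trans ?_)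
    simp [ha, ideal, honestVotes]
  · exact (prob_loop_exists_le _
      (fun j (w : Option (Fin 3 → ℕ)) => w ≠ some (honestVotes ∅ fun i => x i j)) (fun _ => 6 * tail n s) (fun j st => prob_voteFor_ne hn A hdec (fun i => x i j) j st)
      A.init).trans_eq (by simp)

theorem tail_eq (n s : ℕ) :
    tail n s = ENNReal.ofReal (Real.exp (-(1 / (400 * Real.exp 1 ^ 4) * s / n ^ 2))) := by
  unfold tail margin
  congr 3
  rw [div_pow, one_pow]
  ring

/-- Since `margin n ≤ 1/10`, the rate `margin n ^ 2 / 4` is below `log 2`. This lets the veto error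
be absorbed into the voting error. -/
theorem inv_two_pow_le_tail (hn : 3 ≤ n) : (2⁻¹ : ℝ≥0∞) ^ s ≤ tail n s := by
  have hm := margin_pos hn
  have hm' := (margin_le hn).1
  have h2 : (2⁻¹ : ℝ≥0∞) = ENNReal.ofReal (Real.exp (-Real.log 2)) := by
    rw [Real.exp_neg, Real.exp_log (by norm_num), ENNReal.ofReal_inv_of_pos (by norm_num)]
    simp
  rw [h2, ← ENNReal.ofReal_pow (Real.exp_pos _).le, ← Real.exp_nat_mul]
  refine ENNReal.ofReal_le_ofReal (Real.exp_le_exp.2 ?_)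
  have hl : margin n ^ 2 / 4 ≤ Real.log 2 := by
    have := Real.log_two_gt_d9
    nlinarith
  have := mul_le_mul_of_nonneg_right hl (Nat.cast_nonneg (α := ℝ) s)
  linarith

end transmission

end AnonBit

end

/-! ### The error bound with explicit constants -/

theorem mainTheorem8 :
    ∃ K c : ℝ, 0 < K ∧ 0 < c ∧
      ∀ (n s : ℕ), 3 ≤ n →
      ∀ (ord : Fin n → Equiv.Perm (Fin n)), AnonBit.IsOrderings ord →
      ∀ (dec : ℝ → Option ℕ), AnonBit.IsDecoder n dec →
      ∀ (x : AnonBit.Inputs n),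
        -- all participants are honest: the protocol succeeds with the correct output
        (∀ A : AnonBit.Adversary n s ∅,
          (AnonBit.transmission A ord dec x).toOuterMeasure
              {o | o ≠ some fun j => some (AnonBit.ideal x j)}
            ≤ ENNReal.ofReal (K * n * Real.exp (-(c * s / n ^ 2)))) ∧
        -- an active adversary corrupts the participants in `C`
        (∀ (C : Finset (Fin n)) (A : AnonBit.Adversary n s C),
          (AnonBit.transmission A ord dec x).toOuterMeasure {o | ¬ AnonBit.IsCorrect C x o}
            ≤ ENNReal.ofReal (K * n * Real.exp (-(c * s / n ^ 2)))) := by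
  -- The rate is `margin n ^ 2 / 4` without its factor `1 / n ^ 2`. The `6` counts two tails for
  -- three candidates in the honest case; in the corrupt case it is three lower tails plus as much
  -- again to cover `2⁻¹ ^ s`.
  refine ⟨6, 1 / (400 * Real.exp 1 ^ 4), by norm_num, by positivity, ?_⟩
  intro n s hn ord hord dec hdec x
  have hbound : ENNReal.ofReal (6 * n * Real.exp (-(1 / (400 * Real.exp 1 ^ 4) * s / n ^ 2))) =
      n * (6 * AnonBit.tail n s) := by
    rw [AnonBit.tail_eq, ENNReal.ofReal_mul (by positivity), ENNReal.ofReal_mul (by norm_num)]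
    simp only [ENNReal.ofReal_natCast, ENNReal.ofReal_ofNat]
    ring
  rw [hbound]
  refine ⟨fun A => ?_, fun C A => ?_⟩
  · rw [AnonBit.toOuterMeasure_eq_expect]
    exact AnonBit.prob_transmission_ne_ideal_le hn A ord hdec x
  · rw [AnonBit.toOuterMeasure_eq_expect]
    refine (AnonBit.prob_transmission_not_isCorrect_le hn A hord hdec x).trans ?_
    have h1 : (1 : ℝ≥0∞) ≤ n := by exact_mod_cast (by omega : 1 ≤ n)
    calc (n : ℝ≥0∞) * (3 * AnonBit.tail n s) + 2⁻¹ ^ s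
        ≤ n * (3 * AnonBit.tail n s) + n * (3 * AnonBit.tail n s) := by
          refine add_le_add_right ((AnonBit.inv_two_pow_le_tail hn).trans ?_) _
          calc AnonBit.tail n s = 1 * (1 * AnonBit.tail n s) := by ring
            _ ≤ n * (3 * AnonBit.tail n s) := by gcongr; norm_num
      _ = n * (6 * AnonBit.tail n s) := by ring
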